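/- For complex $q$ with $|q|<1$ write $(a;q)_\infty=\prod_{j\ge 0}(1-aq^j)$, $(a,b;q)_\infty=(a;q)_\infty(b;q)_\infty$, and define \begin{align*} S_{A1}(z,q)&=\sum_{n=1}^\infty\frac{q^n(q^{2n+1};q)_\infty}{(zq^n,z^{-1}q^n;q)_\infty},& S_{A3}(z,q)&=\sum_{n=1}^\infty\frac{q^{2n}(q^{2n+1};q)_\infty}{(zq^n,z^{-1}q^n;q)_\infty},\\ S_{C1}(z,q)&=\sum_{n=1}^\infty\frac{q^n(q^{2n+1};q^2)_\infty(q^{n+1};q)_\infty}{(zq^n,z^{-1}q^n;q)_\infty},& S_{E4}(z,q)&=\sum_{n=1}^\infty\frac{q^{2n}(q^{2n+2};q^2)_\infty}{(zq^n,z^{-1}q^n;q)_\infty}. \end{align*} Let $q,z\in\mathbb C$ with $|q|<1$, $z\ne 0$, and $zq^m\neq 1$, $z^{-1}q^m\ne 1$ for all integers $m\ge 1$. Then all the series above and below converge absolutely, the double series also as series over the pairs $(k,n)$, and \begin{align*} (1+z)(z,z^{-1};q)_\infty S_{A1}(z,q)&=-(1+z)(q;q)_\infty\\ &\quad+\frac1{(q;q)_\infty}\sum_{k=1}^\infty(z^k+z^{1-k})\Big((-1)^{k+1}q^{\frac{k(k-1)}2}+\sum_{n=1}^\infty(-1)^{n+k+1}q^{\frac{k(k-1)}2+\frac{n(n-3)}2+2kn}(1+q^n)\Big),\\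 (1+z)(z,z^{-1};q)_\infty S_{A3}(z,q)&=-(1+z)(q;q)_\infty\\ &\quad+\frac1{(q;q)_\infty}\sum_{k=1}^\infty\sum_{n=0}^\infty(z^k+z^{1-k})(-1)^{n+k+1}q^{\frac{k(k+1)}2+\frac{n(n-3)}2+2kn-1}(1-q^{2n+1}),\\ (1+z)(z,z^{-1};q)_\infty S_{C1}(z,q)&=-(1+z)(q;q)_\infty(q;q^2)_\infty\\ &\quad+\frac1{(q;q)_\infty}\sum_{k=1}^\infty\sum_{n=0}^\infty(z^k+z^{1-k})(-1)^{k+1}q^{\frac{k(k-1)}2+\frac{n(3n-1)}2+3kn}(1-q^{2k-1})(1-q^{k+n}),\\ (1+z)(z,z^{-1};q)_\infty S_{E4}(z,q)&=-(1+z)(q^2;q^2)_\infty\\ &\quad+\frac1{(q;q)_\infty}\sum_{k=1}^\infty\sum_{n=0}^\infty(z^k+z^{1-k})(-1)^{k+n+1}q^{\frac{k(k+1)}2+n^2-n+2kn-1}(1-q^{2n+1}). \end{align*} -/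

import Mathlib

noncomputable section

/-- The finite `q`-shifted factorial `(z; q)_n = ∏_{j=0}^{n-1} (1 - z q^j)`. -/
def qPoch (z q : ℂ) (n : ℕ) : ℂ := ∏ j ∈ Finset.range n, (1 - z * q ^ j)

/-- The infinite `q`-shifted factorial `(z; q)_∞ = ∏_{j=0}^∞ (1 - z q^j)`, used for `‖q‖ < 1`,
where the product converges (see `multipliable_qPoch`). -/
def qPochInf (z q : ℂ) : ℂ := ∏' j : ℕ, (1 - z * q ^ j)

/-- The `n`-th term of
`S_{A1}(z,q) = ∑_{n ≥ 1} q^n (q^{2n+1}; q)_∞ / ((z q^n; q)_∞ (z⁻¹ q^n; q)_∞)`. -/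
def termA1 (z q : ℂ) (n : ℕ) : ℂ :=
  q ^ n * qPochInf (q ^ (2 * n + 1)) q / (qPochInf (z * q ^ n) q * qPochInf (z⁻¹ * q ^ n) q)

/-- The `n`-th term of
`S_{A3}(z,q) = ∑_{n ≥ 1} q^{2n} (q^{2n+1}; q)_∞ / ((z q^n; q)_∞ (z⁻¹ q^n; q)_∞)`. -/
def termA3 (z q : ℂ) (n : ℕ) : ℂ :=
  q ^ (2 * n) * qPochInf (q ^ (2 * n + 1)) q /
    (qPochInf (z * q ^ n) q * qPochInf (z⁻¹ * q ^ n) q)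

/-- The `n`-th term of `S_{C1}(z,q) =
∑_{n ≥ 1} q^n (q^{2n+1}; q^2)_∞ (q^{n+1}; q)_∞ / ((z q^n; q)_∞ (z⁻¹ q^n; q)_∞)`. -/
def termC1 (z q : ℂ) (n : ℕ) : ℂ :=
  q ^ n * (qPochInf (q ^ (2 * n + 1)) (q ^ 2) * qPochInf (q ^ (n + 1)) q) /
    (qPochInf (z * q ^ n) q * qPochInf (z⁻¹ * q ^ n) q)

/-- The `n`-th term of
`S_{E4}(z,q) = ∑_{n ≥ 1} q^{2n} (q^{2n+2}; q^2)_∞ / ((z q^n; q)_∞ (z⁻¹ q^n; q)_∞)`. -/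
def termE4 (z q : ℂ) (n : ℕ) : ℂ :=
  q ^ (2 * n) * qPochInf (q ^ (2 * n + 2)) (q ^ 2) /
    (qPochInf (z * q ^ n) q * qPochInf (z⁻¹ * q ^ n) q)

/-- `S_{A1}(z,q)`. In this and the next three definitions the sum is over `n ≥ 1`. -/
def sptCrankA1 (z q : ℂ) : ℂ := ∑' n : ℕ, termA1 z q (n + 1)

/-- `S_{A3}(z,q)`. -/
def sptCrankA3 (z q : ℂ) : ℂ := ∑' n : ℕ, termA3 z q (n + 1)

/-- `S_{C1}(z,q)`. -/
def sptCrankC1 (z q : ℂ) : ℂ := ∑' n : ℕ, termC1 z q (n + 1)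

/-- `S_{E4}(z,q)`. -/
def sptCrankE4 (z q : ℂ) : ℂ := ∑' n : ℕ, termE4 z q (n + 1)

/-! Terms of the double series. All exponents of `q` below are non-negative integers in the
ranges of summation used, and the integer divisions by `2` are exact. -/

/-- `(-1)^{k+1} q^{k(k-1)/2}`, for `k ≥ 1`. -/
def singleA1 (q : ℂ) (k : ℕ) : ℂ :=
  (-1) ^ (k + 1) * q ^ ((k : ℤ) * (k - 1) / 2)

/-- `(-1)^{n+k+1} q^{k(k-1)/2 + n(n-3)/2 + 2kn} (1 + q^n)`, for `k ≥ 1`, `n ≥ 1`. -/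
def doubleA1 (q : ℂ) (k n : ℕ) : ℂ :=
  (-1) ^ (n + k + 1) *
    q ^ ((k : ℤ) * (k - 1) / 2 + (n : ℤ) * (n - 3) / 2 + 2 * k * n) * (1 + q ^ n)

/-- `(-1)^{n+k+1} q^{k(k+1)/2 + n(n-3)/2 + 2kn - 1} (1 - q^{2n+1})`, for `k ≥ 1`, `n ≥ 0`. -/
def doubleA3 (q : ℂ) (k n : ℕ) : ℂ :=
  (-1) ^ (n + k + 1) *
    q ^ ((k : ℤ) * (k + 1) / 2 + (n : ℤ) * (n - 3) / 2 + 2 * k * n - 1) * (1 - q ^ (2 * n + 1))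

/-- `(-1)^{k+1} q^{k(k-1)/2 + n(3n-1)/2 + 3kn} (1 - q^{2k-1}) (1 - q^{k+n})`,
for `k ≥ 1`, `n ≥ 0`. -/
def doubleC1 (q : ℂ) (k n : ℕ) : ℂ :=
  (-1) ^ (k + 1) *
    q ^ ((k : ℤ) * (k - 1) / 2 + (n : ℤ) * (3 * n - 1) / 2 + 3 * k * n) *
    (1 - q ^ (2 * (k : ℤ) - 1)) * (1 - q ^ (k + n))

/-- `(-1)^{k+n+1} q^{k(k+1)/2 + n^2 - n + 2kn - 1} (1 - q^{2n+1})`, for `k ≥ 1`, `n ≥ 0`. -/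
def doubleE4 (q : ℂ) (k n : ℕ) : ℂ :=
  (-1) ^ (k + n + 1) *
    q ^ ((k : ℤ) * (k + 1) / 2 + (n : ℤ) ^ 2 - n + 2 * k * n - 1) * (1 - q ^ (2 * n + 1))

/-- `z^k + z^{1-k}`. -/
def zPair (z : ℂ) (k : ℕ) : ℂ := z ^ (k : ℤ) + z ^ (1 - (k : ℤ))

/-! Checks of the definitions: convergence of the products, and agreement of the series above
with the spt-crank-type form `P(q) / (z, z⁻¹; q)_∞ * ∑_{n ≥ 1} (z, z⁻¹; q)_n q^n β_n`
at the points where `(z, z⁻¹; q)_∞` does not vanish. -/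

theorem multipliable_qPoch (z : ℂ) {q : ℂ} (hq : ‖q‖ < 1) :
    Multipliable fun j : ℕ => 1 - z * q ^ j := by
  have h : Summable fun j : ℕ => ‖-(z * q ^ j)‖ := by
    simp only [norm_neg, norm_mul, norm_pow]
    exact (summable_geometric_of_lt_one (norm_nonneg q) hq).mul_left ‖z‖
  simpa [sub_eq_add_neg] using multipliable_one_add_of_summable h

theorem qPochInf_eq_mul (z : ℂ) {q : ℂ} (hq : ‖q‖ < 1) (n : ℕ) :
    qPochInf z q = qPoch z q n * qPochInf (z * q ^ n) q := by
  have h : Multipliable fun j : ℕ => 1 - z * q ^ (j + n) := by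
    have := multipliable_qPoch (z * q ^ n) hq
    refine this.congr fun j => ?_
    ring
  have h2 := h.prod_mul_tprod_nat_mul' (f := fun j : ℕ => 1 - z * q ^ j) (k := n)
  unfold qPochInf qPoch
  rw [← h2]
  congr 1
  refine tprod_congr fun j => ?_
  ring

theorem qPoch_ne_zero {z q : ℂ} (h : ∀ m : ℕ, z * q ^ m ≠ 1) (n : ℕ) : qPoch z q n ≠ 0 :=
  Finset.prod_ne_zero_iff.2 fun j _ => sub_ne_zero.2 (h j).symm

theorem pow_succ_ne_one {q : ℂ} (hq : ‖q‖ < 1) (m : ℕ) : q ^ (m + 1) ≠ 1 := by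
  intro h
  have h1 : ‖q‖ ^ (m + 1) = 1 := by rw [← norm_pow, h, norm_one]
  exact (pow_lt_one₀ (norm_nonneg q) hq (Nat.succ_ne_zero m)).ne h1

/-- `P / (z, z⁻¹; q)_∞ * ∑_{n ≥ 1} (z, z⁻¹; q)_n q^n β_n`. -/
def sptCrank (P : ℂ) (β : ℕ → ℂ) (z q : ℂ) : ℂ :=
  P / (qPochInf z q * qPochInf z⁻¹ q) *
    ∑' n : ℕ, qPoch z q (n + 1) * qPoch z⁻¹ q (n + 1) * q ^ (n + 1) * β (n + 1)

theorem sptCrank_eq (P : ℂ) (β : ℕ → ℂ) {z q : ℂ} (hq : ‖q‖ < 1)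
    (hz : ∀ m : ℕ, z * q ^ m ≠ 1 ∧ z⁻¹ * q ^ m ≠ 1) :
    sptCrank P β z q = ∑' n : ℕ, q ^ (n + 1) * (P * β (n + 1)) /
      (qPochInf (z * q ^ (n + 1)) q * qPochInf (z⁻¹ * q ^ (n + 1)) q) := by
  unfold sptCrank
  rw [← tsum_mul_left]
  refine tsum_congr fun n => ?_
  rw [qPochInf_eq_mul z hq (n + 1), qPochInf_eq_mul z⁻¹ hq (n + 1)]
  have ha := qPoch_ne_zero (fun m => (hz m).1) (n + 1)
  have hb := qPoch_ne_zero (fun m => (hz m).2) (n + 1)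
  generalize qPoch z q (n + 1) = a at *
  generalize qPoch z⁻¹ q (n + 1) = b at *
  generalize qPochInf (z * q ^ (n + 1)) q = X
  generalize qPochInf (z⁻¹ * q ^ (n + 1)) q = Y
  rcases eq_or_ne X 0 with rfl | hX
  · simp
  rcases eq_or_ne Y 0 with rfl | hY
  · simp
  field_simp

theorem qPoch_q_ne_zero {q : ℂ} (hq : ‖q‖ < 1) (n : ℕ) : qPoch q q n ≠ 0 :=
  qPoch_ne_zero (fun m => by rw [← pow_succ']; exact pow_succ_ne_one hq m) n

theorem norm_sq_lt_one {q : ℂ} (hq : ‖q‖ < 1) : ‖q ^ 2‖ < 1 := by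
  rw [norm_pow]; exact pow_lt_one₀ (norm_nonneg q) hq two_ne_zero

/-- `β_n = 1 / (q; q)_{2n}` and `P = (q; q)_∞`. -/
theorem sptCrankA1_eq {z q : ℂ} (hq : ‖q‖ < 1)
    (hz : ∀ m : ℕ, z * q ^ m ≠ 1 ∧ z⁻¹ * q ^ m ≠ 1) :
    sptCrankA1 z q = sptCrank (qPochInf q q) (fun n => 1 / qPoch q q (2 * n)) z q := by
  rw [sptCrank_eq _ _ hq hz]
  refine tsum_congr fun n => ?_
  have h := qPoch_q_ne_zero hq (2 * (n + 1))
  rw [termA1, qPochInf_eq_mul q hq (2 * (n + 1)), ← pow_succ', mul_one_div,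
    mul_div_cancel_left₀ _ h]

/-- `β_n = q^n / (q; q)_{2n}` and `P = (q; q)_∞`. -/
theorem sptCrankA3_eq {z q : ℂ} (hq : ‖q‖ < 1)
    (hz : ∀ m : ℕ, z * q ^ m ≠ 1 ∧ z⁻¹ * q ^ m ≠ 1) :
    sptCrankA3 z q = sptCrank (qPochInf q q) (fun n => q ^ n / qPoch q q (2 * n)) z q := by
  rw [sptCrank_eq _ _ hq hz]
  refine tsum_congr fun n => ?_
  have h := qPoch_q_ne_zero hq (2 * (n + 1))
  rw [termA3, qPochInf_eq_mul q hq (2 * (n + 1)), ← pow_succ']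
  congr 1
  field_simp
  ring

/-- `β_n = 1 / ((q; q^2)_n (q; q)_n)` and `P = (q; q^2)_∞ (q; q)_∞`. -/
theorem sptCrankC1_eq {z q : ℂ} (hq : ‖q‖ < 1)
    (hz : ∀ m : ℕ, z * q ^ m ≠ 1 ∧ z⁻¹ * q ^ m ≠ 1) :
    sptCrankC1 z q = sptCrank (qPochInf q (q ^ 2) * qPochInf q q)
      (fun n => 1 / (qPoch q (q ^ 2) n * qPoch q q n)) z q := by
  rw [sptCrank_eq _ _ hq hz]
  refine tsum_congr fun n => ?_
  have h := qPoch_q_ne_zero hq (n + 1)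
  have h2 : qPoch q (q ^ 2) (n + 1) ≠ 0 := qPoch_ne_zero (fun m => by
    rw [← pow_mul, ← pow_succ']; exact pow_succ_ne_one hq _) _
  rw [termC1, qPochInf_eq_mul q hq (n + 1), qPochInf_eq_mul q (norm_sq_lt_one hq) (n + 1),
    ← pow_mul, ← pow_succ', ← pow_succ']
  congr 1
  field_simp

/-- `β_n = q^n / (q^2; q^2)_n` and `P = (q^2; q^2)_∞`. -/
theorem sptCrankE4_eq {z q : ℂ} (hq : ‖q‖ < 1)
    (hz : ∀ m : ℕ, z * q ^ m ≠ 1 ∧ z⁻¹ * q ^ m ≠ 1) :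
    sptCrankE4 z q = sptCrank (qPochInf (q ^ 2) (q ^ 2))
      (fun n => q ^ n / qPoch (q ^ 2) (q ^ 2) n) z q := by
  rw [sptCrank_eq _ _ hq hz]
  refine tsum_congr fun n => ?_
  have h := qPoch_q_ne_zero (norm_sq_lt_one hq) (n + 1)
  have e : q ^ 2 * (q ^ 2) ^ (n + 1) = q ^ (2 * (n + 1) + 2) := by ring
  rw [termE4, qPochInf_eq_mul (q ^ 2) (norm_sq_lt_one hq) (n + 1), e]
  congr 1
  field_simp
  ring

end

noncomputable section

open Filter Topology

/-! Since `(z;q)_∞ / (z q^n;q)_∞ = (z;q)_n`, each left side is `∑_{n≥1} w_n (1+z) (z;q)_n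
(z⁻¹;q)_n`, where `w_n` is the numerator in the `n`-th term of the series. Including `n = 0`
accounts for the term `-(1+z) w_0`. The Laurent polynomial `(1+z) (z;q)_n (z⁻¹;q)_n` has an explicit
finite expansion in the `z^{i+1} + z^{-i}` (`one_add_mul_qPoch_mul_qPoch_inv`). Its coefficients are
`O(|q|^{i(i-1)/2})` uniformly in `n`, so the sums over `n` and `i` may be exchanged
(`tsum_crank_eq`).

It remains to evaluate, for each `i`, the sum of `w_n` against the `i`-th coefficient. With `n = m +
i` and `x = q^{2i+1}` this is, up to elementary factors, a sum over `m` of `(x q^{m+1};q)_∞ /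
(q;q)_m` times `q^m` or `q^{2m}`, for C1 and E4 divided by further infinite products. Heine's
transformation (`tsum_heine`), obtained from two uses of the `q`-binomial theorem, applies to all
four.

For A1 and A3 the transformed series is already a partial theta series (`tsum_bailey_A1`,
`tsum_bailey_A3`). For C1 and E4 it is a series of Rogers–Fine type, which satisfies a functional
equation under `y ↦ y q`; iterating that equation gives the partial theta series
(`tsum_qPoch_mul_pow`, `tsum_qPoch_div`, used in `tsum_bailey_C1`, `tsum_bailey_E4`). -/

/-! ### Shifted factorials: recurrences, nonvanishing, bounds. -/

theorem qPoch_zero (a q : ℂ) : qPoch a q 0 = 1 := by simp [qPoch]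

theorem qPoch_succ (a q : ℂ) (n : ℕ) : qPoch a q (n + 1) = qPoch a q n * (1 - a * q ^ n) := by
  simp [qPoch, Finset.prod_range_succ]

theorem qPoch_succ_left (a q : ℂ) (n : ℕ) :
    qPoch a q (n + 1) = (1 - a) * qPoch (a * q) q n := by
  simp only [qPoch, Finset.prod_range_succ', pow_zero, mul_one]
  rw [mul_comm]
  congr 1
  exact Finset.prod_congr rfl fun j _ => by ring

theorem qPoch_add (a q : ℂ) (m n : ℕ) :
    qPoch a q (m + n) = qPoch a q m * qPoch (a * q ^ m) q n := by
  simp only [qPoch, Finset.prod_range_add]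
  congr 1
  exact Finset.prod_congr rfl fun j _ => by ring

theorem zero_qPoch (q : ℂ) (n : ℕ) : qPoch 0 q n = 1 := by simp [qPoch]

theorem zero_qPochInf (q : ℂ) : qPochInf 0 q = 1 := by simp [qPochInf]

theorem tendsto_qPoch (a : ℂ) {q : ℂ} (hq : ‖q‖ < 1) :
    Tendsto (qPoch a q) atTop (𝓝 (qPochInf a q)) :=
  (multipliable_qPoch a hq).tendsto_prod_tprod_nat

theorem qPochInf_ne_zero {a q : ℂ} (hq : ‖q‖ < 1) (h : ∀ j : ℕ, a * q ^ j ≠ 1) :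
    qPochInf a q ≠ 0 := by
  have hs : Summable fun j : ℕ => ‖-(a * q ^ j)‖ := by
    simp only [norm_neg, norm_mul, norm_pow]
    exact (summable_geometric_of_lt_one (norm_nonneg q) hq).mul_left ‖a‖
  have := tprod_one_add_ne_zero_of_summable (f := fun j : ℕ => -(a * q ^ j))
    (fun j => by rw [← sub_eq_add_neg]; exact sub_ne_zero.2 (h j).symm) hs
  simpa [qPochInf, sub_eq_add_neg] using this

theorem exists_norm_le_of_tendsto {u : ℕ → ℂ} {l : ℂ} (h : Tendsto u atTop (𝓝 l)) :
    ∃ M : ℝ, 0 < M ∧ ∀ n, ‖u n‖ ≤ M := by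
  obtain ⟨M, hM⟩ := h.norm.bddAbove_range
  exact ⟨max M 1, by positivity, fun n => (hM ⟨n, rfl⟩).trans (le_max_left _ _)⟩

theorem exists_norm_qPoch_le (a : ℂ) {q : ℂ} (hq : ‖q‖ < 1) :
    ∃ M : ℝ, 0 < M ∧ ∀ n, ‖qPoch a q n‖ ≤ M :=
  exists_norm_le_of_tendsto (tendsto_qPoch a hq)

theorem exists_norm_inv_qPoch_le {a q : ℂ} (hq : ‖q‖ < 1) (h : ∀ j : ℕ, a * q ^ j ≠ 1) :
    ∃ M : ℝ, 0 < M ∧ ∀ n, ‖(qPoch a q n)⁻¹‖ ≤ M :=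
  exists_norm_le_of_tendsto ((tendsto_qPoch a hq).inv₀ (qPochInf_ne_zero hq h))

theorem mul_pow_ne_one {a q : ℂ} (hq : ‖q‖ < 1) (ha : ‖a‖ < 1) (j : ℕ) : a * q ^ j ≠ 1 := by
  intro h
  have h1 : ‖a‖ * ‖q‖ ^ j = 1 := by rw [← norm_pow, ← norm_mul, h, norm_one]
  have h2 : ‖q‖ ^ j ≤ 1 := pow_le_one₀ (norm_nonneg q) hq.le
  nlinarith [norm_nonneg a, norm_nonneg q]

theorem qPoch_ne_zero_of_norm_lt_one {a q : ℂ} (hq : ‖q‖ < 1) (ha : ‖a‖ < 1) (n : ℕ) :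
    qPoch a q n ≠ 0 := qPoch_ne_zero (mul_pow_ne_one hq ha) n

theorem qPochInf_ne_zero_of_norm_lt_one {a q : ℂ} (hq : ‖q‖ < 1) (ha : ‖a‖ < 1) :
    qPochInf a q ≠ 0 := qPochInf_ne_zero hq (mul_pow_ne_one hq ha)

theorem one_sub_pow_ne_zero {q : ℂ} (hq : ‖q‖ < 1) (n : ℕ) : 1 - q ^ (n + 1) ≠ 0 :=
  sub_ne_zero.2 (pow_succ_ne_one hq n).symm

theorem one_sub_ne_zero_of_norm_lt_one {a : ℂ} (ha : ‖a‖ < 1) : 1 - a ≠ 0 :=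
  sub_ne_zero.2 fun h => by simp [← h] at ha

theorem one_add_ne_zero_of_norm_lt_one {a : ℂ} (ha : ‖a‖ < 1) : 1 + a ≠ 0 := by
  have := one_sub_ne_zero_of_norm_lt_one (a := -a) (by simpa using ha)
  simpa using this

theorem norm_mul_pow_lt_one {a q : ℂ} (hq : ‖q‖ < 1) (ha : ‖a‖ < 1) (n : ℕ) :
    ‖a * q ^ n‖ < 1 := by
  rw [norm_mul, norm_pow]
  exact (mul_le_of_le_one_right (norm_nonneg a) (pow_le_one₀ (norm_nonneg q) hq.le)).trans_lt ha

/-! ### The `q`-binomial theorem and Heine's transformation. -/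

/-- The coefficient `∏_{j<n} (b - a q^j) / (q; q)_n` of `z^n` in `(a z; q)_∞ / (b z; q)_∞`. -/
def qBinomCoeff (a b q : ℂ) (n : ℕ) : ℂ :=
  ∏ j ∈ Finset.range n, (b - a * q ^ j) / (1 - q ^ (j + 1))

theorem qBinomCoeff_succ (a b q : ℂ) (n : ℕ) :
    qBinomCoeff a b q (n + 1) = qBinomCoeff a b q n * ((b - a * q ^ n) / (1 - q ^ (n + 1))) := by
  rw [qBinomCoeff, Finset.prod_range_succ, qBinomCoeff]

theorem qBinomCoeff_eq_div (a b q : ℂ) (n : ℕ) :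
    qBinomCoeff a b q n = (∏ j ∈ Finset.range n, (b - a * q ^ j)) / qPoch q q n := by
  simp only [qBinomCoeff, qPoch, Finset.prod_div_distrib, pow_succ']

theorem qBinomCoeff_one_right (a q : ℂ) (n : ℕ) :
    qBinomCoeff a 1 q n = qPoch a q n / qPoch q q n := by
  simp only [qBinomCoeff, qPoch, Finset.prod_div_distrib, pow_succ']

theorem summable_qBinomCoeff (a : ℂ) {b q z : ℂ} (hq : ‖q‖ < 1) (hz : ‖b * z‖ < 1) :
    Summable fun n => ‖qBinomCoeff a b q n * z ^ n‖ := by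
  obtain ⟨r, hr, hr1⟩ := exists_between hz
  have hp : Tendsto (fun n : ℕ => q ^ n) atTop (𝓝 0) :=
    tendsto_pow_atTop_nhds_zero_of_norm_lt_one hq
  have h1 : Tendsto (fun n : ℕ => ‖(b - a * q ^ n) / (1 - q ^ (n + 1)) * z‖) atTop (𝓝 ‖b * z‖) := by
    have h2 : Tendsto (fun n : ℕ => q ^ (n + 1)) atTop (𝓝 0) := (tendsto_add_atTop_iff_nat 1).2 hp
    have h3 := (((hp.const_mul a).const_sub b).div (h2.const_sub 1) (by simp)).mul_const z
    simpa using h3.norm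
  refine summable_of_ratio_norm_eventually_le hr1 ?_
  filter_upwards [h1.eventually_le_const hr] with n hn
  rw [norm_norm, norm_norm, qBinomCoeff_succ]
  calc _ = ‖(b - a * q ^ n) / (1 - q ^ (n + 1)) * z‖ * ‖qBinomCoeff a b q n * z ^ n‖ := by
        rw [← norm_mul]; congr 1; ring
    _ ≤ _ := by gcongr

/-- The series in the `q`-binomial theorem satisfies a first order `q`-difference equation. -/
theorem one_sub_mul_tsum_qBinomCoeff (a : ℂ) {b q z : ℂ} (hq : ‖q‖ < 1) (hz : ‖b * z‖ < 1) :
    (1 - b * z) * ∑' n, qBinomCoeff a b q n * z ^ n =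
      (1 - a * z) * ∑' n, qBinomCoeff a b q n * (z * q) ^ n := by
  have hz' : ‖b * (z * q)‖ < 1 := by
    have := norm_mul_pow_lt_one hq hz 1
    rwa [pow_one, mul_assoc] at this
  have s1 := (summable_qBinomCoeff a hq hz).of_norm
  have s2 := (summable_qBinomCoeff a hq hz').of_norm
  -- The left terms carry the factor `1 - q^n`: the one at `n = 0` drops out, and in the others this
  -- factor cancels the denominator of the coefficient recurrence.
  have e : ∑' n, (qBinomCoeff a b q n * z ^ n - qBinomCoeff a b q n * (z * q) ^ n) =
      ∑' n, (b * z * (qBinomCoeff a b q n * z ^ n) -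
        a * z * (qBinomCoeff a b q n * (z * q) ^ n)) := by
    rw [(s1.sub s2).tsum_eq_zero_add]
    simp only [pow_zero, sub_self, zero_add]
    refine tsum_congr fun n => ?_
    rw [qBinomCoeff_succ]
    have := one_sub_pow_ne_zero hq n
    rw [mul_pow, mul_pow]
    field_simp
    ring
  rw [s1.tsum_sub s2, (s1.mul_left (b * z)).tsum_sub (s2.mul_left (a * z)), tsum_mul_left,
    tsum_mul_left] at e
  linear_combination e

/-- The homogeneous `q`-binomial theorem. -/
theorem tsum_qBinomCoeff (a : ℂ) {b q z : ℂ} (hq : ‖q‖ < 1) (hz : ‖b * z‖ < 1) :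
    ∑' n, qBinomCoeff a b q n * z ^ n = qPochInf (a * z) q / qPochInf (b * z) q := by
  set f : ℂ → ℂ := fun z => ∑' n, qBinomCoeff a b q n * z ^ n with hf
  have key : ∀ N : ℕ, qPoch (b * z) q N * f z = qPoch (a * z) q N * f (z * q ^ N) := by
    intro N
    induction N with
    | zero => simp [qPoch_zero]
    | succ N ih =>
      have h := one_sub_mul_tsum_qBinomCoeff a (z := z * q ^ N) hq
        (by rw [← mul_assoc]; exact norm_mul_pow_lt_one hq hz N)
      rw [qPoch_succ, qPoch_succ, pow_succ, ← mul_assoc z]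
      linear_combination (1 - b * z * q ^ N) * ih + qPoch (a * z) q N * h
  -- Continuity at `0` along `z q^N`: only the constant term survives, with the series at `z` as
  -- dominating series.
  have hlim : Tendsto (fun N : ℕ => f (z * q ^ N)) atTop (𝓝 1) := by
    have h0 : ∑' n, (if n = 0 then (1 : ℂ) else 0) = 1 := tsum_ite_eq 0 _
    rw [← h0]
    refine tendsto_tsum_of_dominated_convergence (summable_qBinomCoeff a hq hz) (fun n => ?_)
      (Eventually.of_forall fun N n => ?_)
    · have hp : Tendsto (fun N : ℕ => z * q ^ N) atTop (𝓝 0) := by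
        simpa using (tendsto_pow_atTop_nhds_zero_of_norm_lt_one hq).const_mul z
      have := (hp.pow n).const_mul (qBinomCoeff a b q n)
      rcases eq_or_ne n 0 with rfl | hn
      · simp [qBinomCoeff]
      · simpa [hn] using this
    · rw [norm_mul, norm_mul, norm_pow, norm_pow, norm_mul]
      gcongr
      rw [norm_pow]
      exact mul_le_of_le_one_right (norm_nonneg z) (pow_le_one₀ (norm_nonneg q) hq.le)
  have hl := (tendsto_qPoch (b * z) hq).mul_const (f z)
  have hr := (tendsto_qPoch (a * z) hq).mul hlim
  rw [← funext key] at hr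
  have := tendsto_nhds_unique hl hr
  rw [eq_div_iff (qPochInf_ne_zero_of_norm_lt_one hq hz), mul_comm, this, mul_one]

/-- Heine's transformation. -/
theorem tsum_heine (a c : ℂ) {b q w : ℂ} (hq : ‖q‖ < 1) (hb : ‖b‖ < 1) (hw : ‖w‖ < 1) :
    ∑' m, w ^ m * (qPoch c q m / qPoch q q m) *
        (qPochInf (a * q ^ m) q / qPochInf (b * q ^ m) q) =
      ∑' j, qBinomCoeff a b q j * (qPochInf (c * (w * q ^ j)) q / qPochInf (w * q ^ j) q) := by
  -- The quotient of products at `q^m` is expanded in powers `(q^m)^j`; after exchanging the sums,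
  -- the sum over `m` is again a `q`-binomial series, at `w q^j`.
  have hsum : Summable (Function.uncurry fun m j : ℕ =>
      qBinomCoeff c 1 q m * w ^ m * (qBinomCoeff a b q j * (q ^ m) ^ j)) := by
    have s1 := summable_qBinomCoeff c (b := 1) (z := w) hq (by simpa using hw)
    have s2 := summable_qBinomCoeff a (b := b) (z := 1) hq (by simpa using hb)
    refine Summable.of_norm_bounded (s1.mul_of_nonneg s2 (fun _ => norm_nonneg _)
      (fun _ => norm_nonneg _)) fun p => ?_
    simp only [Function.uncurry]
    rw [norm_mul]
    gcongr
    rw [norm_mul, norm_mul]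
    gcongr
    rw [norm_pow, norm_pow, one_pow, norm_one]
    exact pow_le_one₀ (by positivity) (pow_le_one₀ (norm_nonneg q) hq.le)
  have hL : ∀ m, ∑' j, qBinomCoeff c 1 q m * w ^ m * (qBinomCoeff a b q j * (q ^ m) ^ j) =
      w ^ m * (qPoch c q m / qPoch q q m) *
        (qPochInf (a * q ^ m) q / qPochInf (b * q ^ m) q) := fun m => by
    rw [tsum_mul_left, tsum_qBinomCoeff a hq (norm_mul_pow_lt_one hq hb m),
      qBinomCoeff_one_right]
    ring
  have hR : ∀ j, ∑' m, qBinomCoeff c 1 q m * w ^ m * (qBinomCoeff a b q j * (q ^ m) ^ j) =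
      qBinomCoeff a b q j * (qPochInf (c * (w * q ^ j)) q / qPochInf (w * q ^ j) q) := fun j => by
    have := tsum_qBinomCoeff c (b := 1) (z := w * q ^ j) hq
      (by rw [one_mul]; exact norm_mul_pow_lt_one hq hw j)
    rw [one_mul] at this
    rw [← this, ← tsum_mul_left]
    refine tsum_congr fun m => ?_
    rw [mul_pow, ← pow_mul, ← pow_mul, mul_comm j m]
    ring
  rw [← tsum_congr hL, ← tsum_congr hR, hsum.tsum_comm]

/-! ### Rogers–Fine type series by iterated functional equations. -/

/-- Iterating `f n = a n + b n * f (n + 1)` with `f` bounded and `∏ b` tending to zero. -/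
theorem eq_tsum_of_iterate {f a b : ℕ → ℂ} {M : ℝ} (h : ∀ n, f n = a n + b n * f (n + 1))
    (hf : ∀ n, ‖f n‖ ≤ M) (hb : Tendsto (fun n => ∏ j ∈ Finset.range n, b j) atTop (𝓝 0))
    (hs : Summable fun n => (∏ j ∈ Finset.range n, b j) * a n) :
    f 0 = ∑' n, (∏ j ∈ Finset.range n, b j) * a n := by
  have key : ∀ N, f 0 = ∑ n ∈ Finset.range N, (∏ j ∈ Finset.range n, b j) * a n +
      (∏ j ∈ Finset.range N, b j) * f N := by
    intro N
    induction N with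
    | zero => simp
    | succ N ih =>
      rw [Finset.sum_range_succ, Finset.prod_range_succ]
      linear_combination ih + (∏ j ∈ Finset.range N, b j) * h N
  have h1 : Tendsto (fun N => (∏ j ∈ Finset.range N, b j) * f N) atTop (𝓝 0) := by
    refine hb.zero_mul_isBoundedUnder_le ⟨M, ?_⟩
    simpa using Eventually.of_forall (f := atTop) hf
  have h2 := hs.hasSum.tendsto_sum_nat.add h1
  rw [← funext key, add_zero] at h2
  exact tendsto_nhds_unique tendsto_const_nhds h2

theorem norm_pow_le_one {q : ℂ} (hq : ‖q‖ < 1) (n : ℕ) : ‖q ^ n‖ ≤ 1 := by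
  rw [norm_pow]; exact pow_le_one₀ (norm_nonneg q) hq.le

theorem summable_pow_mul_pow_mul {x q : ℂ} (hq : ‖q‖ < 1) (hx : ‖x‖ < 1) (e : ℕ → ℕ)
    {g : ℕ → ℂ} {M : ℝ} (hg : ∀ n, ‖g n‖ ≤ M) : Summable fun n => x ^ n * q ^ e n * g n := by
  refine Summable.of_norm_bounded
    ((summable_geometric_of_lt_one (norm_nonneg x) hx).mul_right M) fun n => ?_
  rw [norm_mul, norm_mul, norm_pow]
  have h1 := norm_pow_le_one hq (e n)
  have h2 := hg n
  have h3 : ‖x‖ ^ n * ‖q ^ e n‖ ≤ ‖x‖ ^ n := mul_le_of_le_one_right (by positivity) h1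
  gcongr

theorem tendsto_pow_mul_pow_zero {x q : ℂ} (hq : ‖q‖ < 1) (hx : ‖x‖ < 1) (e : ℕ → ℕ) :
    Tendsto (fun n => x ^ n * q ^ e n) atTop (𝓝 0) := by
  have := (summable_pow_mul_pow_mul hq hx e (g := fun _ => 1) (M := 1)
    (fun _ => by simp)).tendsto_atTop_zero
  simpa using this

/-- The sum of the `n` integers `1, 4, …, 3n - 2`. -/
def pentagonalNum (n : ℕ) : ℕ := ∑ j ∈ Finset.range n, (3 * j + 1)

theorem prod_range_mul_pow (c q : ℂ) (e : ℕ → ℕ) (n : ℕ) :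
    ∏ j ∈ Finset.range n, (c * q ^ e j) = c ^ n * q ^ ∑ j ∈ Finset.range n, e j := by
  rw [Finset.prod_mul_distrib, Finset.prod_pow_eq_pow_sum]
  simp

theorem sum_range_odd (n : ℕ) : ∑ j ∈ Finset.range n, (2 * j + 1) = n ^ 2 := by
  induction n with
  | zero => rfl
  | succ n ih => rw [Finset.sum_range_succ, ih]; ring

theorem sum_range_succ_id (n : ℕ) : ∑ j ∈ Finset.range n, (j + 1) = (n + 1).choose 2 := by
  have h := Finset.sum_range_succ' (fun j : ℕ => j) n
  rw [Nat.choose_two_right, ← Finset.sum_range_id]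
  simpa using h.symm

/-- Bounds for the shifted factorials based at the points `y q^N`, uniform in `N`. -/
theorem exists_norm_qPoch_shift_le {y q : ℂ} (hq : ‖q‖ < 1) (hy : ‖y‖ < 1) :
    ∃ M : ℝ, 0 < M ∧ ∀ N n, ‖qPoch (y * q ^ N) q n‖ ≤ M ∧ ‖(qPoch (y * q ^ N) q n)⁻¹‖ ≤ M := by
  obtain ⟨M₁, h₁, hM₁⟩ := exists_norm_qPoch_le y hq
  obtain ⟨M₂, h₂, hM₂⟩ := exists_norm_inv_qPoch_le hq (mul_pow_ne_one hq hy)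
  refine ⟨M₁ * M₂, by positivity, fun N n => ?_⟩
  have e : qPoch (y * q ^ N) q n = qPoch y q (N + n) * (qPoch y q N)⁻¹ := by
    rw [qPoch_add]
    have := qPoch_ne_zero_of_norm_lt_one hq hy N
    field_simp
  refine ⟨?_, ?_⟩
  · rw [e, norm_mul]
    gcongr
    exacts [hM₁ _, hM₂ _]
  · rw [e, mul_inv, inv_inv, norm_mul, mul_comm]
    gcongr
    exacts [hM₁ _, hM₂ _]

theorem summable_norm_qPoch_mul_pow (a : ℂ) {y q : ℂ} (hq : ‖q‖ < 1) (hy : ‖y‖ < 1) :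
    Summable fun n => ‖qPoch a q n * y ^ n‖ := by
  obtain ⟨M, h, hM⟩ := exists_norm_qPoch_le a hq
  refine Summable.of_nonneg_of_le (fun _ => norm_nonneg _) (fun n => ?_)
    ((summable_geometric_of_lt_one (norm_nonneg y) hy).mul_left M)
  rw [norm_mul, norm_pow]
  gcongr
  exact hM n

/-- Splitting off the first factor of `(y;q)_{n+1}` leads to the mixed series `A = ∑ (yq;q)_n y^n`
(`e0`). Splitting off the last factor of `(yq;q)_{n+1}` gives `(1 - y) A` in terms of the series at
`y q` (`e1`). Eliminating `A` leaves the functional equation. -/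
theorem tsum_qPoch_mul_pow_functional {y q : ℂ} (hq : ‖q‖ < 1) (hy : ‖y‖ < 1) :
    ∑' n, qPoch y q n * y ^ n =
      (1 + y) + -(y ^ 3 * q) * ∑' n, qPoch (y * q) q n * (y * q) ^ n := by
  have hyq : ‖y * q‖ < 1 := by simpa using norm_mul_pow_lt_one hq hy 1
  have s0 := (summable_norm_qPoch_mul_pow y hq hy).of_norm
  have sA := (summable_norm_qPoch_mul_pow (y * q) hq hy).of_norm
  have sB := (summable_norm_qPoch_mul_pow (y * q) hq hyq).of_norm
  have e0 : ∑' n, qPoch y q n * y ^ n = 1 + y * (1 - y) * ∑' n, qPoch (y * q) q n * y ^ n := by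
    rw [s0.tsum_eq_zero_add, ← tsum_mul_left, qPoch_zero, pow_zero, mul_one]
    congr 1
    refine tsum_congr fun n => ?_
    rw [qPoch_succ_left]
    ring
  have e1 : ∑' n, qPoch (y * q) q n * y ^ n = 1 + (y * ∑' n, qPoch (y * q) q n * y ^ n -
      y ^ 2 * q * ∑' n, qPoch (y * q) q n * (y * q) ^ n) := by
    rw [← tsum_mul_left, ← tsum_mul_left, ← (sA.mul_left y).tsum_sub (sB.mul_left (y ^ 2 * q)),
      sA.tsum_eq_zero_add, qPoch_zero, pow_zero, mul_one]
    congr 1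
    refine tsum_congr fun n => ?_
    rw [qPoch_succ]
    ring
  linear_combination e0 + y * e1

/-- The functional equation at `y q^N` has multiplier `-y^3 q^{3N+1}`, so iteration accumulates the
exponents `1 + 4 + … + (3n-2)`. -/
theorem tsum_qPoch_mul_pow {y q : ℂ} (hq : ‖q‖ < 1) (hy : ‖y‖ < 1) :
    ∑' n, qPoch y q n * y ^ n =
      ∑' n, (-y ^ 3) ^ n * q ^ pentagonalNum n * (1 + y * q ^ n) := by
  obtain ⟨M, h, hM⟩ := exists_norm_qPoch_shift_le hq hy
  have hy3 : ‖-y ^ 3‖ < 1 := by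
    rw [norm_neg, norm_pow]; exact pow_lt_one₀ (norm_nonneg y) hy three_ne_zero
  have hp : (fun n => ∏ j ∈ Finset.range n, (-y ^ 3 * q ^ (3 * j + 1))) =
      fun n => (-y ^ 3) ^ n * q ^ pentagonalNum n := funext fun n =>
    prod_range_mul_pow _ _ _ _
  have hyN : ∀ N, ‖y * q ^ N‖ ≤ ‖y‖ := fun N => by
    rw [norm_mul]; exact mul_le_of_le_one_right (norm_nonneg y) (norm_pow_le_one hq N)
  have := eq_tsum_of_iterate (f := fun N => ∑' n, qPoch (y * q ^ N) q n * (y * q ^ N) ^ n)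
    (a := fun N => 1 + y * q ^ N) (b := fun N => -y ^ 3 * q ^ (3 * N + 1))
    (M := ∑' n, M * ‖y‖ ^ n) (fun N => ?_) (fun N => ?_) ?_ ?_
  · simp only [pow_zero, mul_one] at this
    rw [this]
    exact tsum_congr fun n => by rw [congrFun hp n]
  · rw [tsum_qPoch_mul_pow_functional hq (norm_mul_pow_lt_one hq hy N), pow_succ q N, mul_assoc y]
    ring
  · refine tsum_of_norm_bounded
      ((summable_geometric_of_lt_one (norm_nonneg y) hy).mul_left M).hasSum fun n => ?_
    rw [norm_mul, norm_pow]
    gcongr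
    exacts [(hM N n).1, hyN N]
  · rw [hp]; exact tendsto_pow_mul_pow_zero hq hy3 _
  · simp_rw [congrFun hp]
    refine summable_pow_mul_pow_mul hq hy3 _ (M := 2) fun n => ?_
    refine (norm_add_le _ _).trans ?_
    rw [norm_one]
    linarith [hyN n]

theorem summable_qPoch_div {a b y q : ℂ} (hq : ‖q‖ < 1) (hb : ‖b‖ < 1) (hy : ‖y‖ < 1) :
    Summable fun n => qPoch a q n * y ^ n / qPoch b q (n + 1) := by
  obtain ⟨M, h, hM⟩ := exists_norm_inv_qPoch_le hq (mul_pow_ne_one hq hb)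
  refine Summable.of_norm_bounded ((summable_norm_qPoch_mul_pow a hq hy).mul_right M) fun n => ?_
  rw [div_eq_mul_inv, norm_mul]
  gcongr
  exact hM _

/-- Two linear relations between three series of Rogers–Fine type. -/
theorem tsum_qPoch_div_relations {t q : ℂ} (hq : ‖q‖ < 1) (ht : ‖t‖ < 1) :
    (1 + t) * ∑' n, qPoch t q n * t ^ n / qPoch (-t) q (n + 1) =
      1 + t * (1 - t) * ∑' n, qPoch (t * q) q n * t ^ n / qPoch (-(t * q)) q (n + 1) ∧
    (1 - t) * ∑' n, qPoch (t * q) q n * t ^ n / qPoch (-(t * q)) q (n + 1) =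
      1 - t * q * (1 + t) *
        ∑' n, qPoch (t * q) q n * (t * q) ^ n / qPoch (-(t * q)) q (n + 1) := by
  have htq : ‖t * q‖ < 1 := by simpa using norm_mul_pow_lt_one hq ht 1
  have hnt : ‖-t‖ < 1 := by rwa [norm_neg]
  have hntq : ‖-(t * q)‖ < 1 := by rwa [norm_neg]
  have sC := summable_qPoch_div (a := t) (b := -t) (y := t) hq hnt ht
  have sP := summable_qPoch_div (a := t * q) (b := -(t * q)) (y := t) hq hntq ht
  have sQ := summable_qPoch_div (a := t * q) (b := -(t * q)) (y := t * q) hq hntq htq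
  have nd := fun n => qPoch_ne_zero_of_norm_lt_one hq hntq n
  constructor
  · rw [sC.tsum_eq_zero_add, mul_add, ← tsum_mul_left, ← tsum_mul_left]
    have n1 := one_add_ne_zero_of_norm_lt_one ht
    congr 1
    · rw [zero_add, qPoch_succ, qPoch_zero, qPoch_zero]
      simp only [pow_zero, mul_one, one_mul, sub_neg_eq_add]
      field_simp
    · refine tsum_congr fun n => ?_
      rw [qPoch_succ_left t, qPoch_succ_left (-t), neg_mul, sub_neg_eq_add]
      have := nd (n + 1)
      field_simp
      ring
  -- The combination on the left puts the factor `1 + t q^{n+2}` in the numerator, which cancels the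
  -- last factor of the denominator; then `(tq;q)_{n+1} = (tq;q)_n (1 - t q^{n+1})` splits into the
  -- two terms on the right.
  · have e : ∑' n, (qPoch (t * q) q (n + 1) * t ^ (n + 1) / qPoch (-(t * q)) q (n + 1 + 1) +
        t * q * (qPoch (t * q) q (n + 1) * (t * q) ^ (n + 1) / qPoch (-(t * q)) q (n + 1 + 1))) =
      ∑' n, (t * (qPoch (t * q) q n * t ^ n / qPoch (-(t * q)) q (n + 1)) -
        t ^ 2 * q * (qPoch (t * q) q n * (t * q) ^ n / qPoch (-(t * q)) q (n + 1))) := by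
      refine tsum_congr fun n => ?_
      have h1 := nd (n + 1)
      have h2 := nd (n + 1 + 1)
      rw [qPoch_succ (-(t * q)) q (n + 1)] at h2 ⊢
      have h3 := right_ne_zero_of_mul h2
      rw [qPoch_succ (t * q) q n, mul_pow t q]
      have h4 : 1 - -(t * q) * q ^ (n + 1) = 1 + t * q * q ^ (n + 1) := by ring
      rw [h4] at h3 ⊢
      field_simp
      ring
    rw [(sP.mul_left t).tsum_sub (sQ.mul_left (t ^ 2 * q)), tsum_mul_left, tsum_mul_left,
      ((summable_nat_add_iff 1).2 sP).tsum_add (((summable_nat_add_iff 1).2 sQ).mul_left (t * q)),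
      tsum_mul_left] at e
    have eP := sP.tsum_eq_zero_add
    have eQ := sQ.tsum_eq_zero_add
    have n1 := one_add_ne_zero_of_norm_lt_one htq
    have n2 : qPoch (-(t * q)) q (0 + 1) = 1 + t * q := by
      rw [qPoch_succ, qPoch_zero]; ring
    rw [n2, qPoch_zero] at eP eQ
    have n3 : (1 : ℂ) * t ^ 0 / (1 + t * q) * (1 + t * q) = 1 := by field_simp
    have n4 : (1 : ℂ) * (t * q) ^ 0 / (1 + t * q) = 1 * t ^ 0 / (1 + t * q) := by simp
    rw [n4] at eQ
    linear_combination e + eP + t * q * eQ + n3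

/-- Eliminating the mixed series from the two relations leaves a common factor `1 + t`. -/
theorem tsum_qPoch_div_functional {t q : ℂ} (hq : ‖q‖ < 1) (ht : ‖t‖ < 1) :
    ∑' n, qPoch t q n * t ^ n / qPoch (-t) q (n + 1) =
      1 + -(t ^ 2 * q) *
        ∑' n, qPoch (t * q) q n * (t * q) ^ n / qPoch (-(t * q)) q (n + 1) := by
  obtain ⟨h1, h2⟩ := tsum_qPoch_div_relations hq ht
  refine mul_left_cancel₀ (one_add_ne_zero_of_norm_lt_one ht) ?_
  linear_combination h1 + t * h2

/-- At `t q^N` the multiplier is `-t^2 q^{2N+1}`; the odd exponents add up to `n^2`. -/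
theorem tsum_qPoch_div {t q : ℂ} (hq : ‖q‖ < 1) (ht : ‖t‖ < 1) :
    ∑' n, qPoch t q n * t ^ n / qPoch (-t) q (n + 1) = ∑' n, (-t ^ 2) ^ n * q ^ (n ^ 2) := by
  obtain ⟨M, h, hM⟩ := exists_norm_qPoch_shift_le hq ht
  obtain ⟨M', h', hM'⟩ := exists_norm_qPoch_shift_le hq (y := -t) (by rwa [norm_neg])
  have ht2 : ‖-t ^ 2‖ < 1 := by
    rw [norm_neg, norm_pow]; exact pow_lt_one₀ (norm_nonneg t) ht two_ne_zero
  have hp : (fun n => ∏ j ∈ Finset.range n, (-t ^ 2 * q ^ (2 * j + 1))) =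
      fun n => (-t ^ 2) ^ n * q ^ (n ^ 2) := funext fun n => by
    rw [prod_range_mul_pow, sum_range_odd]
  have htN : ∀ N, ‖t * q ^ N‖ ≤ ‖t‖ := fun N => by
    rw [norm_mul]; exact mul_le_of_le_one_right (norm_nonneg t) (norm_pow_le_one hq N)
  have := eq_tsum_of_iterate
    (f := fun N => ∑' n, qPoch (t * q ^ N) q n * (t * q ^ N) ^ n / qPoch (-(t * q ^ N)) q (n + 1))
    (a := fun _ => 1) (b := fun N => -t ^ 2 * q ^ (2 * N + 1))
    (M := ∑' n, M * ‖t‖ ^ n * M') (fun N => ?_) (fun N => ?_) ?_ ?_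
  · simp only [pow_zero, mul_one] at this
    rw [this]
    exact tsum_congr fun n => congrFun hp n
  · rw [tsum_qPoch_div_functional hq (norm_mul_pow_lt_one hq ht N), pow_succ q N, mul_assoc t]
    ring
  · refine tsum_of_norm_bounded
      (((summable_geometric_of_lt_one (norm_nonneg t) ht).mul_left M).mul_right M').hasSum
      fun n => ?_
    rw [div_eq_mul_inv, norm_mul, norm_mul, norm_pow, ← neg_mul]
    gcongr
    exacts [(hM N n).1, htN N, (hM' N _).2]
  · rw [hp]; exact tendsto_pow_mul_pow_zero hq ht2 _
  · simp_rw [congrFun hp]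
    exact summable_pow_mul_pow_mul hq ht2 _ (M := 1) fun n => by simp

/-! ### The four sums over `m` as partial theta series. -/

theorem qPochInf_pow_succ {q : ℂ} (hq : ‖q‖ < 1) (j : ℕ) :
    qPochInf (q ^ (j + 1)) q = qPochInf q q / qPoch q q j := by
  rw [qPochInf_eq_mul q hq j, pow_succ', mul_div_cancel_left₀ _ (qPoch_q_ne_zero hq j)]

theorem prod_zero_sub_mul_pow (x q : ℂ) (n : ℕ) :
    ∏ j ∈ Finset.range n, (0 - x * q * q ^ j) = (-x) ^ n * q ^ (n + 1).choose 2 := by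
  rw [← sum_range_succ_id, ← prod_range_mul_pow]
  exact Finset.prod_congr rfl fun j _ => by ring

theorem qPoch_mul_pow (a c q : ℂ) (n : ℕ) :
    qPoch a q n * c ^ n = ∏ j ∈ Finset.range n, (c * (1 - a * q ^ j)) := by
  rw [Finset.prod_mul_distrib, Finset.prod_const, Finset.card_range, mul_comm]
  rfl

theorem choose_succ_two (n : ℕ) : (n + 1).choose 2 = n + n.choose 2 := by
  rw [Nat.choose_succ_succ' n 1, Nat.choose_one_right]

/-- Heine's transformation with vanishing parameters `b = c = 0`. -/
theorem tsum_pow_mul_qPochInf_div {x q w : ℂ} (hq : ‖q‖ < 1) (hw : ‖w‖ < 1) :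
    ∑' m, w ^ m * (qPochInf (x * q ^ (m + 1)) q / qPoch q q m) =
      ∑' j, (-x) ^ j * q ^ (j + 1).choose 2 / (qPoch q q j * qPochInf (w * q ^ j) q) := by
  have h := tsum_heine (x * q) 0 (b := 0) hq (by simp) hw
  simp only [zero_mul, zero_qPochInf, zero_qPoch, div_one, qBinomCoeff_eq_div,
    prod_zero_sub_mul_pow] at h
  convert h using 1
  · exact tsum_congr fun m => by rw [mul_assoc x, ← pow_succ']; ring
  · exact tsum_congr fun m => by rw [div_mul_div_comm, mul_one]

/-- At `w = q` the denominators `(q;q)_j (q^{j+1};q)_∞` after Heine all equal `(q;q)_∞`, leaving `∑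
(-x)^j q^{j(j+1)/2}`. Multiplying by `1 - x` and pairing neighbouring terms gives the right side. -/
theorem tsum_bailey_A1 {x q : ℂ} (hq : ‖q‖ < 1) (hx : ‖x‖ < 1) :
    (1 - x) * (qPochInf q q * ∑' m, q ^ m * (qPochInf (x * q ^ (m + 1)) q / qPoch q q m)) =
      1 + ∑' n : ℕ, (-x) ^ (n + 1) * q ^ (n + 1).choose 2 * (1 + q ^ (n + 1)) := by
  have hx' : ‖-x‖ < 1 := by rwa [norm_neg]
  have hs : Summable fun j : ℕ => (-x) ^ j * q ^ (j + 1).choose 2 := by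
    simpa using summable_pow_mul_pow_mul hq hx' (fun j => (j + 1).choose 2) (g := fun _ => 1)
      (M := 1)
      fun _ => by simp
  have e : qPochInf q q * ∑' m, q ^ m * (qPochInf (x * q ^ (m + 1)) q / qPoch q q m) =
      ∑' j : ℕ, (-x) ^ j * q ^ (j + 1).choose 2 := by
    rw [tsum_pow_mul_qPochInf_div hq hq, ← tsum_mul_left]
    refine tsum_congr fun j => ?_
    rw [← pow_succ', qPochInf_pow_succ hq j]
    have h1 := qPoch_q_ne_zero hq j
    have h2 := qPochInf_ne_zero_of_norm_lt_one hq hq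
    field_simp
  have e2 : ∑' n : ℕ, (-x) ^ (n + 1) * q ^ (n + 1).choose 2 * (1 + q ^ (n + 1)) =
      ∑' n : ℕ, (-x * ((-x) ^ n * q ^ (n + 1).choose 2) +
        (-x) ^ (n + 1) * q ^ (n + 1 + 1).choose 2) := by
    refine tsum_congr fun n => ?_
    rw [choose_succ_two (n + 1), pow_add q (n + 1)]
    ring
  rw [e, e2, (hs.mul_left (-x)).tsum_add ((summable_nat_add_iff 1).2 hs), tsum_mul_left]
  have := hs.tsum_eq_zero_add
  simp only [pow_zero, zero_add, Nat.choose_succ_self, mul_one] at this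
  linear_combination this

/-- At `w = q^2` Heine leaves an extra factor `1 - q^{j+1}`. The factor `1 - x` is matched through
`1 - q^{2n+1} = q^n (1 - q^{n+1}) + (1 - q^n)`: the second part is `-x` times the first, shifted by
one. -/
theorem tsum_bailey_A3 {x q : ℂ} (hq : ‖q‖ < 1) (hx : ‖x‖ < 1) :
    (1 - x) * (qPochInf q q * ∑' m, (q ^ 2) ^ m * (qPochInf (x * q ^ (m + 1)) q / qPoch q q m)) =
      ∑' n : ℕ, (-x) ^ n * q ^ n.choose 2 * (1 - q ^ (2 * n + 1)) := by
  have hx' : ‖-x‖ < 1 := by rwa [norm_neg]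
  have hs1 : Summable fun j : ℕ => (-x) ^ j * q ^ (j + 1).choose 2 * (1 - q ^ (j + 1)) :=
    summable_pow_mul_pow_mul hq hx' (fun j => (j + 1).choose 2) (M := 2) fun n => by
      refine (norm_sub_le _ _).trans ?_
      rw [norm_one]; linarith [norm_pow_le_one hq (n + 1)]
  have hs2 : Summable fun j : ℕ => (-x) ^ j * q ^ j.choose 2 * (1 - q ^ j) :=
    summable_pow_mul_pow_mul hq hx' (fun j => j.choose 2) (M := 2) fun n => by
      refine (norm_sub_le _ _).trans ?_
      rw [norm_one]; linarith [norm_pow_le_one hq n]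
  have e : qPochInf q q * ∑' m, (q ^ 2) ^ m * (qPochInf (x * q ^ (m + 1)) q / qPoch q q m) =
      ∑' j : ℕ, (-x) ^ j * q ^ (j + 1).choose 2 * (1 - q ^ (j + 1)) := by
    rw [tsum_pow_mul_qPochInf_div hq (norm_sq_lt_one hq), ← tsum_mul_left]
    refine tsum_congr fun j => ?_
    have e1 : q ^ 2 * q ^ j = q ^ (j + 1 + 1) := by ring
    rw [e1, qPochInf_pow_succ hq (j + 1)]
    have h1 := qPoch_q_ne_zero hq j
    have h2 := qPochInf_ne_zero_of_norm_lt_one hq hq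
    have h3 := one_sub_pow_ne_zero hq j
    rw [qPoch_succ, ← pow_succ']
    field_simp
  have e2 : ∑' n : ℕ, (-x) ^ n * q ^ n.choose 2 * (1 - q ^ (2 * n + 1)) =
      ∑' n : ℕ, ((-x) ^ n * q ^ (n + 1).choose 2 * (1 - q ^ (n + 1)) +
        (-x) ^ n * q ^ n.choose 2 * (1 - q ^ n)) := by
    refine tsum_congr fun n => ?_
    rw [choose_succ_two n, pow_add q n]
    ring
  have e3 : ∑' n : ℕ, (-x) ^ n * q ^ n.choose 2 * (1 - q ^ n) =
      -x * ∑' j : ℕ, (-x) ^ j * q ^ (j + 1).choose 2 * (1 - q ^ (j + 1)) := by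
    rw [hs2.tsum_eq_zero_add, ← tsum_mul_left]
    simp only [pow_zero, sub_self, mul_zero, zero_add]
    exact tsum_congr fun n => by ring
  rw [e, e2, hs1.tsum_add hs2, e3]
  ring

/-- Heine with `a = y^2`, `b = -y`, `c = 0`, `w = q`. Because `a = b^2`, the product of the `b - a
q^i` is `(-y;q)_j (-y)^j`, so `tsum_qPoch_mul_pow` applies at `-y`. -/
theorem tsum_bailey_C1 {y q : ℂ} (hq : ‖q‖ < 1) (hy : ‖y‖ < 1) :
    qPochInf q q * ∑' m, q ^ m * (qPochInf (y ^ 2 * q ^ m) q /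
        (qPochInf (-y * q ^ m) q * qPoch q q m)) =
      ∑' n : ℕ, y ^ (3 * n) * q ^ pentagonalNum n * (1 - y * q ^ n) := by
  have hy' : ‖-y‖ < 1 := by rwa [norm_neg]
  have h := tsum_heine (y ^ 2) 0 hq hy' hq
  simp only [zero_mul, zero_qPochInf, zero_qPoch] at h
  have h2 := tsum_qPoch_mul_pow hq hy'
  have e : ∑' m, q ^ m * (qPochInf (y ^ 2 * q ^ m) q / (qPochInf (-y * q ^ m) q * qPoch q q m)) =
      ∑' m, q ^ m * (1 / qPoch q q m) * (qPochInf (y ^ 2 * q ^ m) q / qPochInf (-y * q ^ m) q) :=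
    tsum_congr fun m => by rw [mul_assoc, div_mul_div_comm, one_mul, mul_comm (qPoch q q m)]
  have e2 : ∑' n : ℕ, y ^ (3 * n) * q ^ pentagonalNum n * (1 - y * q ^ n) =
      ∑' n : ℕ, (-(-y) ^ 3) ^ n * q ^ pentagonalNum n * (1 + -y * q ^ n) :=
    tsum_congr fun n => by
      rw [pow_mul, show -(-y) ^ 3 = y ^ 3 by ring]
      ring
  rw [e, e2, ← h2, h, ← tsum_mul_left]
  refine tsum_congr fun j => ?_
  rw [← pow_succ', qPochInf_pow_succ hq j, qBinomCoeff_eq_div]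
  have h1 := qPoch_q_ne_zero hq j
  have h2 := qPochInf_ne_zero_of_norm_lt_one hq hq
  have e3 : ∏ i ∈ Finset.range j, (-y - y ^ 2 * q ^ i) = qPoch (-y) q j * (-y) ^ j := by
    rw [qPoch_mul_pow]
    exact Finset.prod_congr rfl fun i _ => by ring
  rw [e3]
  field_simp

/-- Heine with `a = t^2 q`, `b = t`, `c = -t`, `w = q^2` gives `(P - q Q) / (1 + t)`, where `P` and
`Q` are the series of `tsum_qPoch_div_relations` with powers of `t` and of `t q`. The second
relation there turns `(1 - t)(P - q Q)` into `(1 - t^2 q Q) - q Q`. By the functional equation and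
`tsum_qPoch_div` this is `T(t) - q T(tq)` with `T(t) = ∑ (-t^2)^n q^{n^2}`. -/
theorem tsum_bailey_E4 {t q : ℂ} (hq : ‖q‖ < 1) (ht : ‖t‖ < 1) :
    (1 - t ^ 2) * (qPochInf q q * ∑' m, (q ^ 2) ^ m * (qPochInf (t ^ 2 * q ^ (m + 1)) q /
        (qPochInf (t * q ^ m) q * qPochInf (-t * q ^ m) q * qPoch q q m))) =
      ∑' n : ℕ, (-t ^ 2) ^ n * q ^ (n ^ 2) * (1 - q ^ (2 * n + 1)) := by
  have htq : ‖t * q‖ < 1 := by simpa using norm_mul_pow_lt_one hq ht 1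
  have hnt : ‖-t‖ < 1 := by rwa [norm_neg]
  have hntq : ‖-(t * q)‖ < 1 := by rwa [norm_neg]
  have ht2 : ‖-t ^ 2‖ < 1 := by
    rw [norm_neg, norm_pow]; exact pow_lt_one₀ (norm_nonneg t) ht two_ne_zero
  have sP := summable_qPoch_div (a := t * q) (b := -(t * q)) (y := t) hq hntq ht
  have sQ := summable_qPoch_div (a := t * q) (b := -(t * q)) (y := t * q) hq hntq htq
  have n1 := qPochInf_ne_zero_of_norm_lt_one hq hq
  have n2 := qPochInf_ne_zero_of_norm_lt_one hq hnt
  have h := tsum_heine (t ^ 2 * q) (-t) hq ht (norm_sq_lt_one hq)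
  have e : qPochInf q q * ∑' m, (q ^ 2) ^ m * (qPochInf (t ^ 2 * q ^ (m + 1)) q /
        (qPochInf (t * q ^ m) q * qPochInf (-t * q ^ m) q * qPoch q q m)) =
      qPochInf q q / qPochInf (-t) q * ∑' m, (q ^ 2) ^ m * (qPoch (-t) q m / qPoch q q m) *
        (qPochInf (t ^ 2 * q * q ^ m) q / qPochInf (t * q ^ m) q) := by
    rw [← tsum_mul_left, ← tsum_mul_left]
    refine tsum_congr fun m => ?_
    have h1 := qPoch_q_ne_zero hq m
    have h2 := qPochInf_ne_zero_of_norm_lt_one hq (norm_mul_pow_lt_one hq ht m)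
    rw [qPochInf_eq_mul (-t) hq m] at n2 ⊢
    have h3 := left_ne_zero_of_mul n2
    have h4 := right_ne_zero_of_mul n2
    rw [mul_assoc (t ^ 2), ← pow_succ']
    field_simp
  have e2 : qPochInf q q / qPochInf (-t) q * ∑' j, qBinomCoeff (t ^ 2 * q) t q j *
        (qPochInf (-t * (q ^ 2 * q ^ j)) q / qPochInf (q ^ 2 * q ^ j) q) =
      1 / (1 + t) * ∑' n, (qPoch (t * q) q n * t ^ n / qPoch (-(t * q)) q (n + 1) -
        q * (qPoch (t * q) q n * (t * q) ^ n / qPoch (-(t * q)) q (n + 1))) := by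
    rw [← tsum_mul_left, ← tsum_mul_left]
    refine tsum_congr fun j => ?_
    have e1 : q ^ 2 * q ^ j = q ^ (j + 1 + 1) := by ring
    have e3 : ∏ i ∈ Finset.range j, (t - t ^ 2 * q * q ^ i) = qPoch (t * q) q j * t ^ j := by
      rw [qPoch_mul_pow]
      exact Finset.prod_congr rfl fun i _ => by ring
    rw [e1, qPochInf_pow_succ hq (j + 1), qBinomCoeff_eq_div, e3]
    rw [qPochInf_eq_mul (-t) hq (j + 1 + 1), qPoch_succ_left (-t)] at n2 ⊢
    have h1 := qPoch_q_ne_zero hq j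
    have h3 := one_sub_pow_ne_zero hq j
    have h5 := left_ne_zero_of_mul n2
    have h6 := left_ne_zero_of_mul h5
    have h7 := right_ne_zero_of_mul h5
    have h4 := right_ne_zero_of_mul n2
    rw [neg_mul, sub_neg_eq_add] at *
    rw [qPoch_succ q, ← pow_succ']
    rw [mul_pow t q]
    field_simp
    ring
  rw [e, h, e2, sP.tsum_sub (sQ.mul_left q), tsum_mul_left]
  have hT1 := tsum_qPoch_div hq ht
  have hT2 := tsum_qPoch_div hq htq
  obtain ⟨r1, r2⟩ := tsum_qPoch_div_relations hq ht
  have hf := tsum_qPoch_div_functional hq ht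
  rw [hT1, hT2] at hf
  have s1 : Summable fun n : ℕ => (-t ^ 2) ^ n * q ^ (n ^ 2) := by
    simpa using summable_pow_mul_pow_mul hq ht2 (fun n => n ^ 2) (g := fun _ => 1) (M := 1)
      fun _ => by simp
  have s2 : Summable fun n : ℕ => (-(t * q) ^ 2) ^ n * q ^ (n ^ 2) := by
    have := summable_pow_mul_pow_mul (x := -(t * q) ^ 2) hq (by
      rw [norm_neg, norm_pow]; exact pow_lt_one₀ (norm_nonneg _) htq two_ne_zero)
      (fun n => n ^ 2) (g := fun _ => 1) (M := 1)
      fun _ => by simp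
    simpa using this
  have e4 : ∑' n : ℕ, (-t ^ 2) ^ n * q ^ (n ^ 2) * (1 - q ^ (2 * n + 1)) =
      ∑' n : ℕ, ((-t ^ 2) ^ n * q ^ (n ^ 2) - q * ((-(t * q) ^ 2) ^ n * q ^ (n ^ 2))) := by
    refine tsum_congr fun n => ?_
    rw [show -(t * q) ^ 2 = -t ^ 2 * q ^ 2 by ring, mul_pow, ← pow_mul q]
    ring
  rw [e4, s1.tsum_sub (s2.mul_left q), tsum_mul_left, hf]
  rw [hT2] at r2 ⊢
  have n3 := one_add_ne_zero_of_norm_lt_one ht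
  have e5 : (1 - t ^ 2) * (1 / (1 + t)) = 1 - t := by field_simp; ring
  rw [← mul_assoc, e5]
  linear_combination r2

/-! ### The finite expansion of `(1 + z) (z, z⁻¹; q)_n`. -/

/-- The coefficient of `z^{i+1} + z^{-i}` in `(1 + z) (z, z⁻¹; q)_n`. -/
def crankCoeff (q : ℂ) (n i : ℕ) : ℂ :=
  if i ≤ n then qPoch q q (2 * n) * ((-1) ^ i * (1 - q ^ (2 * i + 1)) * q ^ i.choose 2) /
    (qPoch q q (n + i + 1) * qPoch q q (n - i)) else 0

theorem crankCoeff_add (q : ℂ) (m i : ℕ) :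
    crankCoeff q (m + i) i =
      qPoch q q (2 * (m + i)) * ((-1) ^ i * (1 - q ^ (2 * i + 1)) * q ^ i.choose 2) /
        (qPoch q q (m + (2 * i + 1)) * qPoch q q m) := by
  rw [crankCoeff, if_pos (Nat.le_add_left i m), Nat.add_sub_cancel,
    show m + i + i + 1 = m + (2 * i + 1) by ring]

theorem crankCoeff_of_lt {q : ℂ} {n i : ℕ} (h : n < i) : crankCoeff q n i = 0 :=
  if_neg (not_le.2 h)

/-- `crankCoeff q (d + i) i` up to elementary factors. -/
def crankBase (q : ℂ) (d i : ℕ) : ℂ :=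
  qPoch q q (2 * (d + i)) * ((-1) ^ i * q ^ i.choose 2) /
    (qPoch q q (d + (2 * i + 1)) * qPoch q q d)

theorem crankCoeff_add_eq (q : ℂ) (d i : ℕ) :
    crankCoeff q (d + i) i = crankBase q d i * (1 - q ^ (2 * i + 1)) := by
  rw [crankCoeff_add, crankBase]; ring

theorem crankCoeff_add_succ {q : ℂ} (hq : ‖q‖ < 1) (d i : ℕ) :
    crankCoeff q (d + i) (i + 1) = -crankBase q d i *
      ((1 - q ^ (2 * i + 3)) * q ^ i * (1 - q ^ d) / (1 - q ^ (d + 2 * i + 2))) := by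
  cases d with
  -- Here the index is out of range, and the factor `1 - q^d` makes the formula vanish as well.
  | zero => rw [crankCoeff_of_lt (by omega)]; simp
  | succ d =>
    rw [show d + 1 + i = d + (i + 1) by ring, crankCoeff_add, crankBase,
      show d + (2 * (i + 1) + 1) = d + 1 + (2 * i + 1) + 1 by ring, qPoch_succ q q (d + 1 + _),
      qPoch_succ q q d, choose_succ_two, show d + 1 + i = d + (i + 1) by ring]
    have h1 := qPoch_q_ne_zero hq d
    have h2 := qPoch_q_ne_zero hq (d + 1 + (2 * i + 1))
    have h3 := one_sub_pow_ne_zero hq d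
    have h4 := one_sub_pow_ne_zero hq (d + 1 + (2 * i + 1))
    rw [← pow_succ', ← pow_succ', show d + 1 + 2 * i + 2 = d + 1 + (2 * i + 1) + 1 by ring,
      pow_add q i]
    field_simp
    ring

/-- The difference `q^{2i+1} - q^{2i+d}` is `q^{2i+1} (1 - q^{d-1})` without subtraction in the
exponent; it gives the required zero at `d = 1`. -/
theorem crankCoeff_add_succ_succ {q : ℂ} (hq : ‖q‖ < 1) (d i : ℕ) :
    crankCoeff q (d + i) (i + 2) = crankBase q d i *
      ((1 - q ^ (2 * i + 5)) * (1 - q ^ d) * (q ^ (2 * i + 1) - q ^ (2 * i + d)) /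
        ((1 - q ^ (d + 2 * i + 2)) * (1 - q ^ (d + 2 * i + 3)))) := by
  cases d with
  | zero => rw [crankCoeff_of_lt (by omega)]; simp
  | succ d =>
    rw [show d + 1 + i = d + (i + 1) by ring, crankCoeff_add_succ hq, crankBase, crankBase,
      show d + (2 * (i + 1) + 1) = d + 1 + (2 * i + 1) + 1 by ring, qPoch_succ q q (d + 1 + _),
      qPoch_succ q q d, choose_succ_two, show d + 1 + i = d + (i + 1) by ring]
    have h1 := qPoch_q_ne_zero hq d
    have h2 := qPoch_q_ne_zero hq (d + 1 + (2 * i + 1))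
    have h3 := one_sub_pow_ne_zero hq d
    have h4 := one_sub_pow_ne_zero hq (d + 1 + (2 * i + 1))
    have h5 := one_sub_pow_ne_zero hq (d + 1 + (2 * i + 2))
    rw [← pow_succ', ← pow_succ', show d + 1 + 2 * i + 2 = d + 1 + (2 * i + 1) + 1 by ring,
      show d + 2 * (i + 1) + 2 = d + 1 + (2 * i + 2) + 1 by ring,
      show d + 1 + 2 * i + 3 = d + 1 + (2 * i + 2) + 1 by ring, pow_add q i]
    field_simp
    ring

/-- This is multiplication by `(1 - z q^n)(1 - z⁻¹ q^n) = 1 + q^{2n} - q^n (z + z⁻¹)` read on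
coefficients. All four coefficients are rational multiples of `crankBase q (n - i) i`, which reduces
the claim to an identity of rational functions. -/
theorem crankCoeff_succ_succ {q : ℂ} (hq : ‖q‖ < 1) {n i : ℕ} (hi : i ≤ n) :
    crankCoeff q (n + 1) (i + 1) = (1 + q ^ (2 * n)) * crankCoeff q n (i + 1) -
      q ^ n * (crankCoeff q n i + crankCoeff q n (i + 2)) := by
  obtain ⟨d, rfl⟩ := Nat.exists_eq_add_of_le' hi
  have e : crankCoeff q (d + i + 1) (i + 1) = -crankBase q d i *
      ((1 - q ^ (2 * (d + i) + 1)) * (1 - q ^ (2 * (d + i) + 2)) * (1 - q ^ (2 * i + 3)) * q ^ i /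
        ((1 - q ^ (d + 2 * i + 2)) * (1 - q ^ (d + 2 * i + 3)))) := by
    rw [add_assoc, crankCoeff_add, crankBase, choose_succ_two,
      show d + (2 * (i + 1) + 1) = d + (2 * i + 1) + 1 + 1 by ring,
      show 2 * (d + (i + 1)) = 2 * (d + i) + 1 + 1 by ring,
      qPoch_succ q q (d + (2 * i + 1) + 1), qPoch_succ q q (d + (2 * i + 1)),
      qPoch_succ q q (2 * (d + i) + 1), qPoch_succ q q (2 * (d + i))]
    have h1 := qPoch_q_ne_zero hq d
    have h2 := qPoch_q_ne_zero hq (d + (2 * i + 1))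
    have h4 := one_sub_pow_ne_zero hq (d + (2 * i + 1))
    have h5 := one_sub_pow_ne_zero hq (d + (2 * i + 1) + 1)
    simp only [← pow_succ']
    rw [show d + 2 * i + 2 = d + (2 * i + 1) + 1 by ring,
      show d + 2 * i + 3 = d + (2 * i + 1) + 1 + 1 by ring, pow_add q i]
    field_simp
    ring
  rw [e, crankCoeff_add_succ hq, crankCoeff_add_succ_succ hq, crankCoeff_add_eq]
  have h4 : 1 - q ^ (d + 2 * i + 2) ≠ 0 := one_sub_pow_ne_zero hq (d + 2 * i + 1)
  have h5 : 1 - q ^ (d + 2 * i + 3) ≠ 0 := one_sub_pow_ne_zero hq (d + 2 * i + 2)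
  field_simp
  ring

theorem crankCoeff_succ_zero {q : ℂ} (hq : ‖q‖ < 1) (n : ℕ) :
    crankCoeff q (n + 1) 0 = (1 + q ^ (2 * n)) * crankCoeff q n 0 -
      q ^ n * (crankCoeff q n 0 + crankCoeff q n 1) := by
  have e : crankCoeff q (n + 1) 0 = crankBase q n 0 *
      ((1 - q ^ (2 * n + 1)) * (1 - q ^ (2 * n + 2)) * (1 - q) /
        ((1 - q ^ (n + 1)) * (1 - q ^ (n + 2)))) := by
    have := crankCoeff_add q (n + 1) 0
    rw [add_zero] at this
    rw [this, crankBase, show n + 1 + (2 * 0 + 1) = n + 1 + 1 by ring,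
      show 2 * (n + 1) = 2 * n + 1 + 1 by ring, show n + (2 * 0 + 1) = n + 1 by ring,
      qPoch_succ q q (n + 1), qPoch_succ q q n,
      qPoch_succ q q (2 * n + 1), qPoch_succ q q (2 * n)]
    have h1 := qPoch_q_ne_zero hq n
    have h4 := one_sub_pow_ne_zero hq n
    have h5 := one_sub_pow_ne_zero hq (n + 1)
    simp only [← pow_succ', mul_zero, zero_add, pow_zero, pow_one, Nat.choose_zero_succ, mul_one,
      one_mul]
    field_simp
    ring_nf
  have e1 := crankCoeff_add_succ hq n 0
  have e2 := crankCoeff_add_eq q n 0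
  simp only [add_zero, mul_zero, zero_add, pow_zero, mul_one, pow_one] at e1 e2
  rw [e, e1, e2]
  have h4 := one_sub_pow_ne_zero hq n
  have h5 := one_sub_pow_ne_zero hq (n + 1)
  field_simp
  ring

theorem zPair_one (z : ℂ) : zPair z 1 = z + 1 := by simp [zPair]

theorem add_inv_mul_zPair {z : ℂ} (hz : z ≠ 0) (i : ℕ) :
    (z + z⁻¹) * zPair z (i + 2) = zPair z (i + 3) + zPair z (i + 1) := by
  simp only [zPair]
  push_cast
  have e1 : (1 : ℤ) - (i + 2) = -(i : ℤ) - 1 := by ring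
  have e2 : (1 : ℤ) - (i + 3) = -(i : ℤ) - 2 := by ring
  have e3 : (1 : ℤ) - (i + 1) = -(i : ℤ) := by ring
  rw [e1, e2, e3]
  simp only [zpow_add₀ hz, zpow_sub₀ hz, zpow_neg, zpow_natCast, zpow_ofNat]
  field_simp
  ring

/-- Reflection at the boundary: `zPair z 0 = zPair z 1`. This is why the recurrence for index `0`
contains `crankCoeff q n 0` twice. -/
theorem add_inv_mul_zPair_one {z : ℂ} (hz : z ≠ 0) :
    (z + z⁻¹) * zPair z 1 = zPair z 2 + zPair z 1 := by
  have e : (1 : ℤ) - 2 = -1 := rfl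
  simp only [zPair, Nat.cast_one, Nat.cast_ofNat, e, sub_self, zpow_neg, zpow_ofNat]
  field_simp
  ring

/-- The finite expansion of `(1 + z) (z, z⁻¹; q)_n`. -/
theorem one_add_mul_qPoch_mul_qPoch_inv {z q : ℂ} (hq : ‖q‖ < 1) (hz : z ≠ 0) (n : ℕ) :
    (1 + z) * (qPoch z q n * qPoch z⁻¹ q n) =
      ∑ i ∈ Finset.range (n + 1), zPair z (i + 1) * crankCoeff q n i := by
  induction n with
  | zero =>
    have := crankCoeff_add q 0 0
    simp only [zero_add, mul_zero, qPoch_succ, qPoch_zero, pow_zero, pow_one, Nat.choose_zero_succ,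
      mul_one, one_mul] at this
    have h : (1 : ℂ) - q ≠ 0 := one_sub_ne_zero_of_norm_lt_one hq
    rw [div_self h] at this
    simp [qPoch_zero, this, zPair_one, add_comm]
  | succ n ih =>
    -- The index `0` obeys its own recurrence and is split off. The sums in `e2`–`e4` are brought to
    -- the common range using that coefficients with index above `n` vanish.
    have e1 : ∑ i ∈ Finset.range (n + 1 + 1), zPair z (i + 1) * crankCoeff q (n + 1) i =
        (1 + q ^ (2 * n)) * ∑ i ∈ Finset.range (n + 1), zPair z (i + 1 + 1) * crankCoeff q n (i + 1)
        - q ^ n * (∑ i ∈ Finset.range (n + 1), zPair z (i + 1 + 1) * crankCoeff q n i +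
            ∑ i ∈ Finset.range (n + 1), zPair z (i + 1 + 1) * crankCoeff q n (i + 2)) +
        zPair z 1 * crankCoeff q (n + 1) 0 := by
      rw [Finset.sum_range_succ', ← Finset.sum_add_distrib, Finset.mul_sum, Finset.mul_sum,
        ← Finset.sum_sub_distrib]
      congr 1
      refine Finset.sum_congr rfl fun i hi => ?_
      rw [crankCoeff_succ_succ hq (Nat.lt_succ_iff.1 (Finset.mem_range.1 hi))]
      ring
    have e2 : ∑ i ∈ Finset.range (n + 1), zPair z (i + 1) * crankCoeff q n i =
        ∑ i ∈ Finset.range (n + 1), zPair z (i + 1 + 1) * crankCoeff q n (i + 1) +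
          zPair z 1 * crankCoeff q n 0 := by
      rw [Finset.sum_range_succ', Finset.sum_range_succ _ n, crankCoeff_of_lt (Nat.lt_succ_self n)]
      simp
    have e3 : (z + z⁻¹) * ∑ i ∈ Finset.range (n + 1), zPair z (i + 1) * crankCoeff q n i =
        ∑ i ∈ Finset.range (n + 1), zPair z (i + 1 + 1) * crankCoeff q n i +
          (zPair z 1 * crankCoeff q n 0 +
            ∑ i ∈ Finset.range (n + 1), zPair z (i + 1) * crankCoeff q n (i + 1)) := by
      rw [Finset.sum_range_succ (fun i => zPair z (i + 1) * crankCoeff q n (i + 1)) n,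
        crankCoeff_of_lt (Nat.lt_succ_self n), mul_zero, add_zero,
        Finset.sum_range_succ', Finset.sum_range_succ' _ n, mul_add, Finset.mul_sum, zero_add,
        ← mul_assoc (z + z⁻¹), add_inv_mul_zPair_one hz]
      have : ∀ i ∈ Finset.range n, (z + z⁻¹) * (zPair z (i + 1 + 1) * crankCoeff q n (i + 1)) =
          zPair z (i + 1 + 1 + 1) * crankCoeff q n (i + 1) +
            zPair z (i + 1) * crankCoeff q n (i + 1) := fun i _ => by
        linear_combination crankCoeff q n (i + 1) * add_inv_mul_zPair hz i
      rw [Finset.sum_congr rfl this, Finset.sum_add_distrib]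
      ring
    have e4 : ∑ i ∈ Finset.range (n + 1), zPair z (i + 1) * crankCoeff q n (i + 1) =
        ∑ i ∈ Finset.range (n + 1), zPair z (i + 1 + 1) * crankCoeff q n (i + 2) +
          zPair z 1 * crankCoeff q n 1 := by
      rw [Finset.sum_range_succ', Finset.sum_range_succ _ n,
        crankCoeff_of_lt (i := n + 2) (by omega)]
      simp
    rw [e1, qPoch_succ, qPoch_succ, crankCoeff_succ_zero hq]
    have e5 : (1 - z * q ^ n) * (1 - z⁻¹ * q ^ n) = 1 + q ^ (2 * n) - q ^ n * (z + z⁻¹) := by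
      field_simp
      ring
    linear_combination (1 + q ^ (2 * n) - q ^ n * (z + z⁻¹)) * ih + (1 + q ^ (2 * n)) * e2 -
      q ^ n * e3 - q ^ n * e4 + (1 + z) * (qPoch z q n * qPoch z⁻¹ q n) * e5

/-! ### Convergence, and the exchange of the sums over `n` and `i`. -/

theorem summable_pow_mul_pow_choose {B r : ℝ} (hB : 0 ≤ B) (hr : 0 ≤ r) (hr1 : r < 1) :
    Summable fun i : ℕ => B ^ i * r ^ i.choose 2 := by
  have h : Tendsto (fun i : ℕ => B * r ^ i) atTop (𝓝 0) := by
    simpa using (tendsto_pow_atTop_nhds_zero_of_lt_one hr hr1).const_mul B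
  refine summable_of_ratio_norm_eventually_le (r := 1 / 2) (by norm_num) ?_
  filter_upwards [h.eventually_le_const (show (0 : ℝ) < 1 / 2 by norm_num)] with i hi
  rw [Real.norm_of_nonneg (by positivity), Real.norm_of_nonneg (by positivity), choose_succ_two]
  calc _ = B * r ^ i * (B ^ i * r ^ i.choose 2) := by ring
    _ ≤ _ := by gcongr

theorem norm_zPair_succ_le (z : ℂ) (i : ℕ) :
    ‖zPair z (i + 1)‖ ≤ 2 * (‖z‖ + ‖z⁻¹‖ + 1) ^ (i + 1) := by
  have e : zPair z (i + 1) = z ^ (i + 1) + z⁻¹ ^ i := by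
    rw [zPair]
    push_cast
    rw [show (1 : ℤ) - (i + 1) = -(i : ℤ) by ring, zpow_neg, zpow_natCast, inv_pow]
    norm_cast
  rw [e, two_mul]
  refine (norm_add_le _ _).trans (add_le_add ?_ ?_)
  · rw [norm_pow]
    gcongr
    linarith [norm_nonneg z⁻¹]
  · rw [norm_pow]
    refine (pow_le_pow_left₀ (norm_nonneg _) (?_ : _ ≤ ‖z‖ + ‖z⁻¹‖ + 1) i).trans
      (pow_le_pow_right₀ ?_ (Nat.le_succ i))
    · linarith [norm_nonneg z]
    · linarith [norm_nonneg z, norm_nonneg z⁻¹]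

theorem summable_norm_zPair_mul_pow (z : ℂ) {q : ℂ} (hq : ‖q‖ < 1) :
    Summable fun i : ℕ => ‖zPair z (i + 1)‖ * ‖q‖ ^ i.choose 2 := by
  refine Summable.of_nonneg_of_le (fun _ => by positivity) (fun i => ?_)
    ((summable_pow_mul_pow_choose (B := ‖z‖ + ‖z⁻¹‖ + 1) (by positivity) (norm_nonneg q)
      hq).mul_left
      (2 * (‖z‖ + ‖z⁻¹‖ + 1)))
  calc _ ≤ 2 * (‖z‖ + ‖z⁻¹‖ + 1) ^ (i + 1) * ‖q‖ ^ i.choose 2 := by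
        gcongr; exact norm_zPair_succ_le z i
    _ = _ := by ring

/-- Uniformity in `n` is the point: the quadratic exponent beats the geometric growth of `zPair z (i
+ 1)`, so the double series is dominated by a product of two convergent series. -/
theorem exists_norm_crankCoeff_le {q : ℂ} (hq : ‖q‖ < 1) :
    ∃ C : ℝ, 0 < C ∧ ∀ n i, ‖crankCoeff q n i‖ ≤ C * ‖q‖ ^ i.choose 2 := by
  obtain ⟨M, h, hM⟩ := exists_norm_qPoch_le q hq
  obtain ⟨M', h', hM'⟩ := exists_norm_inv_qPoch_le hq (mul_pow_ne_one hq hq)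
  refine ⟨M * 2 * (M' * M'), by positivity, fun n i => ?_⟩
  rw [crankCoeff]
  split_ifs
  · rw [div_eq_mul_inv, mul_inv]
    have h2 : ‖1 - q ^ (2 * i + 1)‖ ≤ 2 := by
      refine (norm_sub_le _ _).trans ?_
      rw [norm_one]; linarith [norm_pow_le_one hq (2 * i + 1)]
    simp only [norm_mul, norm_pow, norm_neg, norm_one, one_pow, one_mul]
    calc _ ≤ M * (2 * ‖q‖ ^ i.choose 2) * (M' * M') := by
          gcongr
          exacts [hM _, hM' _, hM' _]
      _ = _ := by ring
  · rw [norm_zero]; positivity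

/-- Termwise expansion of `(1 + z) (z, z⁻¹; q)_∞ ∑_{n ≥ 1} w_n / (z q^n, z⁻¹ q^n; q)_∞` in powers
of `z`. -/
theorem tsum_crank_eq {z q : ℂ} (hq : ‖q‖ < 1) (hz : z ≠ 0)
    (hzq : ∀ m : ℕ, 1 ≤ m → z * q ^ m ≠ 1 ∧ z⁻¹ * q ^ m ≠ 1) {w R : ℕ → ℂ} {C : ℝ}
    (hw : ∀ n, ‖w n‖ ≤ C * ‖q‖ ^ n)
    (hR : ∀ i, ∑' m, w (m + i) * crankCoeff q (m + i) i = R i) :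
    Summable (fun n : ℕ => w (n + 1) /
      (qPochInf (z * q ^ (n + 1)) q * qPochInf (z⁻¹ * q ^ (n + 1)) q)) ∧
    (1 + z) * (qPochInf z q * qPochInf z⁻¹ q) * ∑' n : ℕ, w (n + 1) /
      (qPochInf (z * q ^ (n + 1)) q * qPochInf (z⁻¹ * q ^ (n + 1)) q) =
      -(1 + z) * w 0 + ∑' i, zPair z (i + 1) * R i := by
  -- The base points are `z q` and `z⁻¹ q`, as `z = 1` is allowed and `(z;q)_∞` may then vanish.
  have hz1 : ∀ j, z * q * q ^ j ≠ 1 := fun j => by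
    rw [mul_assoc, ← pow_succ']; exact (hzq (j + 1) (by omega)).1
  have hz2 : ∀ j, z⁻¹ * q * q ^ j ≠ 1 := fun j => by
    rw [mul_assoc, ← pow_succ']; exact (hzq (j + 1) (by omega)).2
  have inv : ∀ a : ℂ, (∀ j, a * q * q ^ j ≠ 1) → ∀ n, (qPochInf (a * q ^ (n + 1)) q)⁻¹ =
      qPoch (a * q) q n / qPochInf (a * q) q := fun a ha n => by
    have h := qPochInf_ne_zero hq ha
    rw [qPochInf_eq_mul (a * q) hq n, mul_assoc a, ← pow_succ'] at h ⊢
    rw [div_mul_cancel_left₀ (left_ne_zero_of_mul h)]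
  have nz : ∀ a : ℂ, (∀ j, a * q * q ^ j ≠ 1) → ∀ n, qPochInf (a * q ^ (n + 1)) q ≠ 0 :=
    fun a ha n => qPochInf_ne_zero hq fun j => by
      have := ha (n + j)
      rwa [mul_assoc, ← pow_succ', show n + j + 1 = n + 1 + j by ring, pow_add, ← mul_assoc] at this
  have hwB : Summable fun n => C * ‖q‖ ^ n :=
    (summable_geometric_of_lt_one (norm_nonneg q) hq).mul_left C
  have hwS : Summable fun n => ‖w n‖ := Summable.of_nonneg_of_le (fun _ => norm_nonneg _) hw hwB
  refine ⟨?_, ?_⟩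
  · obtain ⟨M₁, h₁, hM₁⟩ := exists_norm_qPoch_le (z * q) hq
    obtain ⟨M₂, h₂, hM₂⟩ := exists_norm_qPoch_le (z⁻¹ * q) hq
    refine Summable.of_norm_bounded (((summable_nat_add_iff 1).2 hwS).mul_right
      (M₁ / ‖qPochInf (z * q) q‖ * (M₂ / ‖qPochInf (z⁻¹ * q) q‖))) fun n => ?_
    rw [div_eq_mul_inv, mul_inv, inv z hz1, inv z⁻¹ hz2, norm_mul, norm_mul, norm_div, norm_div]
    gcongr
    exacts [hM₁ n, hM₂ n]
  obtain ⟨K, hK, hcK⟩ := exists_norm_crankCoeff_le hq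
  have hF : Summable (Function.uncurry fun n i : ℕ =>
      w n * (zPair z (i + 1) * crankCoeff q n i)) := by
    refine Summable.of_norm_bounded (hwS.mul_of_nonneg
      ((summable_norm_zPair_mul_pow z hq).mul_left K) (fun _ => norm_nonneg _)
      fun _ => by positivity) fun p => ?_
    simp only [Function.uncurry, norm_mul]
    calc _ ≤ ‖w p.1‖ * (‖zPair z (p.2 + 1)‖ * (K * ‖q‖ ^ p.2.choose 2)) := by
          gcongr; exact hcK _ _
      _ = _ := by ring
  have hrow : ∀ n, ∑' i, w n * (zPair z (i + 1) * crankCoeff q n i) =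
      (1 + z) * (qPoch z q n * qPoch z⁻¹ q n) * w n := fun n => by
    have h0 : ∀ i ∉ Finset.range (n + 1), zPair z (i + 1) * crankCoeff q n i = 0 := fun i hi => by
      rw [crankCoeff_of_lt (not_lt.1 (Finset.mem_range.not.1 hi)), mul_zero]
    rw [tsum_mul_left, one_add_mul_qPoch_mul_qPoch_inv hq hz, mul_comm, tsum_eq_sum h0]
  have hcol : ∀ i, ∑' n, w n * (zPair z (i + 1) * crankCoeff q n i) = zPair z (i + 1) * R i :=
      fun i => by
    have hs : Summable fun n => w n * crankCoeff q n i := by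
      refine Summable.of_norm_bounded (hwS.mul_right (K * ‖q‖ ^ i.choose 2)) fun n => ?_
      rw [norm_mul]
      gcongr
      exact hcK _ _
    -- The polynomial with index `n < i` does not reach `z^{i+1}`, so the column effectively starts
    -- at `n = i`.
    have h0 : ∑ n ∈ Finset.range i, w n * crankCoeff q n i = 0 :=
      Finset.sum_eq_zero fun n hn => by rw [crankCoeff_of_lt (Finset.mem_range.1 hn), mul_zero]
    rw [← hR, ← zero_add (∑' m, w (m + i) * crankCoeff q (m + i) i), ← h0,
      hs.sum_add_tsum_nat_add i, ← tsum_mul_left]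
    exact tsum_congr fun n => by ring
  have h1 := hF.tsum_comm
  rw [tsum_congr hrow, tsum_congr hcol] at h1
  have hS1 : Summable fun n => (1 + z) * (qPoch z q n * qPoch z⁻¹ q n) * w n :=
    by simpa only [Function.uncurry, hrow] using hF.prod
  -- The row `n = 0` is `(1 + z) w 0`; moved across, it becomes the leading term of the result.
  rw [hS1.tsum_eq_zero_add, qPoch_zero, qPoch_zero] at h1
  rw [h1, ← tsum_mul_left]
  have h2 : ∀ n, (1 + z) * (qPochInf z q * qPochInf z⁻¹ q) * (w (n + 1) /
      (qPochInf (z * q ^ (n + 1)) q * qPochInf (z⁻¹ * q ^ (n + 1)) q)) =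
      (1 + z) * (qPoch z q (n + 1) * qPoch z⁻¹ q (n + 1)) * w (n + 1) := fun n => by
    rw [qPochInf_eq_mul z hq (n + 1), qPochInf_eq_mul z⁻¹ hq (n + 1)]
    have a1 := nz z hz1 n
    have a2 := nz z⁻¹ hz2 n
    generalize qPochInf (z * q ^ (n + 1)) q = X at *
    generalize qPochInf (z⁻¹ * q ^ (n + 1)) q = Y at *
    rw [mul_div_assoc', div_eq_iff (mul_ne_zero a1 a2)]
    ring
  rw [tsum_congr h2]
  ring

/-! ### Infinite products occurring in the weights. -/

theorem exists_norm_qPochInf_shift_le {a q : ℂ} (hq : ‖q‖ < 1) (ha : ‖a‖ < 1) :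
    ∃ M : ℝ, 0 < M ∧ ∀ n, ‖qPochInf (a * q ^ n) q‖ ≤ M := by
  obtain ⟨M, h, hM⟩ := exists_norm_inv_qPoch_le hq (mul_pow_ne_one hq ha)
  refine ⟨(‖qPochInf a q‖ + 1) * M, by positivity, fun n => ?_⟩
  have h1 := qPochInf_eq_mul a hq n
  have h2 := qPoch_ne_zero_of_norm_lt_one hq ha n
  have e : qPochInf (a * q ^ n) q = qPochInf a q * (qPoch a q n)⁻¹ := by
    rw [h1]; field_simp
  rw [e, norm_mul]
  gcongr
  exacts [by linarith, hM n]

theorem qPochInf_split (a : ℂ) {q : ℂ} (hq : ‖q‖ < 1) :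
    qPochInf a q = qPochInf a (q ^ 2) * qPochInf (a * q) (q ^ 2) := by
  have he : (fun k => 1 - a * (q ^ 2) ^ k) = fun k : ℕ => 1 - a * q ^ (2 * k) :=
    funext fun k => by rw [pow_mul]
  have ho : (fun k => 1 - a * q * (q ^ 2) ^ k) = fun k : ℕ => 1 - a * q ^ (2 * k + 1) :=
    funext fun k => by ring
  have h1 := multipliable_qPoch a (norm_sq_lt_one hq)
  have h2 := multipliable_qPoch (a * q) (norm_sq_lt_one hq)
  rw [qPochInf, qPochInf, qPochInf]
  rw [he] at h1 ⊢
  rw [ho] at h2 ⊢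
  exact (tprod_even_mul_odd (f := fun j => 1 - a * q ^ j) h1 h2).symm

theorem qPochInf_sq (a : ℂ) {q : ℂ} (hq : ‖q‖ < 1) :
    qPochInf (a ^ 2) (q ^ 2) = qPochInf a q * qPochInf (-a) q := by
  simp only [qPochInf]
  rw [← (multipliable_qPoch a hq).tprod_mul (multipliable_qPoch (-a) hq)]
  exact tprod_congr fun j => by ring

/-- The infinite product cancels the factor `(q;q)_{2n}` of the coefficient, `n = m + i`, and
`(q;q)_∞ / (q;q)_{m+2i+1}` is again a tail product. What remains is a Heine summand with `x =
q^{2i+1}`. -/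
theorem qPochInf_mul_crankCoeff {q : ℂ} (hq : ‖q‖ < 1) (m i : ℕ) :
    qPochInf (q ^ (2 * (m + i) + 1)) q * crankCoeff q (m + i) i =
      (-1) ^ i * (1 - q ^ (2 * i + 1)) * q ^ i.choose 2 *
        (qPochInf (q ^ (2 * i + 1) * q ^ (m + 1)) q / qPoch q q m) := by
  rw [crankCoeff_add, ← pow_add, show 2 * i + 1 + (m + 1) = m + (2 * i + 1) + 1 by ring,
    qPochInf_pow_succ hq, qPochInf_pow_succ hq]
  have h1 := qPoch_q_ne_zero hq m
  have h2 := qPoch_q_ne_zero hq (m + (2 * i + 1))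
  have h3 := qPoch_q_ne_zero hq (2 * (m + i))
  field_simp

/-! ### Integer exponents rewritten as natural ones. -/

theorem intCast_choose_two (n : ℕ) : ((n.choose 2 : ℕ) : ℤ) * 2 = n * (n - 1) := by
  induction n with
  | zero => simp
  | succ n ih => rw [choose_succ_two]; push_cast; linarith

theorem intCast_pentagonalNum (n : ℕ) : (pentagonalNum n : ℤ) * 2 = n * (3 * n - 1) := by
  induction n with
  | zero => simp [pentagonalNum]
  | succ n ih =>
    rw [pentagonalNum, Finset.sum_range_succ, ← pentagonalNum]; push_cast; linarith

theorem int_mul_sub_one_div_two (n : ℕ) : (n : ℤ) * (n - 1) / 2 = n.choose 2 :=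
  Int.ediv_eq_of_eq_mul_left two_ne_zero (intCast_choose_two n).symm

theorem int_mul_add_one_div_two (n : ℕ) : (n : ℤ) * (n + 1) / 2 = n.choose 2 + n :=
  Int.ediv_eq_of_eq_mul_left two_ne_zero (by linarith [intCast_choose_two n])

theorem int_mul_sub_three_div_two (n : ℕ) : (n : ℤ) * (n - 3) / 2 = n.choose 2 - n :=
  Int.ediv_eq_of_eq_mul_left two_ne_zero (by linarith [intCast_choose_two n])

theorem int_pentagonal_div_two (n : ℕ) : (n : ℤ) * (3 * n - 1) / 2 = pentagonalNum n :=
  Int.ediv_eq_of_eq_mul_left two_ne_zero (intCast_pentagonalNum n).symm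

theorem singleA1_succ (q : ℂ) (i : ℕ) :
    singleA1 q (i + 1) = (-1) ^ i * q ^ (i + 1).choose 2 := by
  rw [singleA1, int_mul_sub_one_div_two, zpow_natCast]
  ring

theorem doubleA1_succ (q : ℂ) (i n : ℕ) : doubleA1 q (i + 1) (n + 1) =
    (-1) ^ (i + n + 1) * q ^ ((i + 1).choose 2 + (n + 1).choose 2 + (2 * i + 1) * (n + 1)) *
      (1 + q ^ (n + 1)) := by
  rw [doubleA1, int_mul_sub_one_div_two, int_mul_sub_three_div_two]
  congr 2
  · ring
  · rw [← zpow_natCast]; congr 1; push_cast; ring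

/-- With `k = i + 1`, the possibly negative `n(n-3)/2` is absorbed by `2kn` and the `-1` by
`k(k+1)/2`. The exponent is then a natural number, so the rewriting is valid at `q = 0` too. -/
theorem doubleA3_succ (q : ℂ) (i n : ℕ) : doubleA3 q (i + 1) n =
    (-1) ^ (i + n) * q ^ ((i + 1).choose 2 + i + n.choose 2 + (2 * i + 1) * n) *
      (1 - q ^ (2 * n + 1)) := by
  rw [doubleA3, int_mul_add_one_div_two, int_mul_sub_three_div_two]
  congr 2
  · ring
  · rw [← zpow_natCast]; congr 1; push_cast; ring

theorem doubleC1_succ (q : ℂ) (i n : ℕ) : doubleC1 q (i + 1) n =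
    (-1) ^ i * q ^ ((i + 1).choose 2 + pentagonalNum n + 3 * (i + 1) * n) *
      (1 - q ^ (2 * i + 1)) * (1 - q ^ (i + 1 + n)) := by
  rw [doubleC1, int_mul_sub_one_div_two, int_pentagonal_div_two]
  congr 3
  · ring
  · rw [← zpow_natCast]; congr 1; push_cast; ring

theorem doubleE4_succ (q : ℂ) (i n : ℕ) : doubleE4 q (i + 1) n =
    (-1) ^ (i + n) * q ^ ((i + 1).choose 2 + i + n ^ 2 + (2 * i + 1) * n) *
      (1 - q ^ (2 * n + 1)) := by
  rw [doubleE4, int_mul_add_one_div_two]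
  congr 2
  · ring
  · rw [← zpow_natCast]; congr 1; push_cast; ring

/-! ### Absolute convergence of the double series. -/

theorem norm_one_sub_pow_le {q : ℂ} (hq : ‖q‖ < 1) (n : ℕ) : ‖1 - q ^ n‖ ≤ 2 := by
  refine (norm_sub_le _ _).trans ?_
  rw [norm_one]; linarith [norm_pow_le_one hq n]

theorem norm_one_add_pow_le {q : ℂ} (hq : ‖q‖ < 1) (n : ℕ) : ‖1 + q ^ n‖ ≤ 2 := by
  refine (norm_add_le _ _).trans ?_
  rw [norm_one]; linarith [norm_pow_le_one hq n]

theorem choose_two_le_succ (i : ℕ) : i.choose 2 ≤ (i + 1).choose 2 := by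
  rw [choose_succ_two]; omega

/-- The lower bound on the exponent decouples the indices: quadratic decay in `i` controls `zPair`,
and a geometric factor suffices in `n`. -/
theorem summable_zPair_mul_double (z : ℂ) {q : ℂ} (hq : ‖q‖ < 1) (e s : ℕ → ℕ → ℕ)
    {u d : ℕ → ℕ → ℂ} {C : ℝ} (hu : ∀ i n, ‖u i n‖ ≤ C) (he : ∀ i n, i.choose 2 + n ≤ e i n)
    (hd : ∀ i n, d i n = (-1) ^ s i n * q ^ e i n * u i n) :
    Summable fun p : ℕ × ℕ => zPair z (p.1 + 1) * d p.1 p.2 := by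
  have hg := summable_geometric_of_lt_one (norm_nonneg q) hq
  refine Summable.of_norm_bounded (((summable_norm_zPair_mul_pow z hq).mul_of_nonneg hg
    (fun _ => by positivity) fun _ => by positivity).mul_right C) fun p => ?_
  rw [hd, norm_mul, norm_mul, norm_mul, norm_pow, norm_pow, norm_neg, norm_one, one_pow, one_mul]
  calc _ ≤ ‖zPair z (p.1 + 1)‖ * (‖q‖ ^ (p.1.choose 2 + p.2) * C) := by
        have h1 := pow_le_pow_of_le_one (norm_nonneg q) hq.le (he p.1 p.2)
        gcongr
        exact hu _ _
    _ = _ := by rw [pow_add]; ring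

theorem summable_zPair_mul_doubleA1 (z : ℂ) {q : ℂ} (hq : ‖q‖ < 1) :
    Summable fun p : ℕ × ℕ => zPair z (p.1 + 1) * doubleA1 q (p.1 + 1) (p.2 + 1) :=
  summable_zPair_mul_double z hq
    (fun i n => (i + 1).choose 2 + (n + 1).choose 2 + (2 * i + 1) * (n + 1))
    (fun i n => i + n + 1) (d := fun i n => doubleA1 q (i + 1) (n + 1))
    (u := fun _ n => 1 + q ^ (n + 1))
    (fun _ _ => norm_one_add_pow_le hq _)
    (fun i n => by
      have h1 := choose_two_le_succ i
      have h2 : (2 * i + 1) * (n + 1) = 2 * (i * (n + 1)) + n + 1 := by ring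
      omega) (doubleA1_succ q)

theorem summable_zPair_mul_doubleA3 (z : ℂ) {q : ℂ} (hq : ‖q‖ < 1) :
    Summable fun p : ℕ × ℕ => zPair z (p.1 + 1) * doubleA3 q (p.1 + 1) p.2 :=
  summable_zPair_mul_double z hq (fun i n => (i + 1).choose 2 + i + n.choose 2 + (2 * i + 1) * n)
    (fun i n => i + n) (d := fun i n => doubleA3 q (i + 1) n) (u := fun _ n => 1 - q ^ (2 * n + 1))
    (fun _ _ => norm_one_sub_pow_le hq _)
    (fun i n => by
      have h1 := choose_two_le_succ i
      have h2 : (2 * i + 1) * n = 2 * (i * n) + n := by ring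
      omega) (doubleA3_succ q)

theorem summable_zPair_mul_doubleC1 (z : ℂ) {q : ℂ} (hq : ‖q‖ < 1) :
    Summable fun p : ℕ × ℕ => zPair z (p.1 + 1) * doubleC1 q (p.1 + 1) p.2 :=
  summable_zPair_mul_double z hq (fun i n => (i + 1).choose 2 + pentagonalNum n + 3 * (i + 1) * n)
    (fun i _ => i) (d := fun i n => doubleC1 q (i + 1) n)
    (u := fun i n => (1 - q ^ (2 * i + 1)) * (1 - q ^ (i + 1 + n))) (C := 2 * 2)
    (fun _ _ => by
      rw [norm_mul]
      gcongr
      exacts [norm_one_sub_pow_le hq _, norm_one_sub_pow_le hq _])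
    (fun i n => by
      have h1 := choose_two_le_succ i
      have h2 : 3 * (i + 1) * n = 3 * (i * n) + 3 * n := by ring
      omega)
    (fun i n => by rw [doubleC1_succ]; ring)

theorem summable_zPair_mul_doubleE4 (z : ℂ) {q : ℂ} (hq : ‖q‖ < 1) :
    Summable fun p : ℕ × ℕ => zPair z (p.1 + 1) * doubleE4 q (p.1 + 1) p.2 :=
  summable_zPair_mul_double z hq (fun i n => (i + 1).choose 2 + i + n ^ 2 + (2 * i + 1) * n)
    (fun i n => i + n) (d := fun i n => doubleE4 q (i + 1) n) (u := fun _ n => 1 - q ^ (2 * n + 1))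
    (fun _ _ => norm_one_sub_pow_le hq _)
    (fun i n => by
      have h1 := choose_two_le_succ i
      have h2 : (2 * i + 1) * n = 2 * (i * n) + n := by ring
      omega) (doubleE4_succ q)

/-! ### The coefficient of `z^{i+1} + z^{-i}` in the four cases. -/

theorem norm_pow_odd_lt_one {q : ℂ} (hq : ‖q‖ < 1) (i : ℕ) : ‖q ^ (2 * i + 1)‖ < 1 := by
  rw [norm_pow]; exact pow_lt_one₀ (norm_nonneg q) hq (by omega)

/-- With `x = q^{2i+1}`, the factor `1 - q^{2i+1}` of `crankCoeff` is precisely the `1 - x` in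
`tsum_bailey_A1`. -/
theorem tsum_termA1_coeff {q : ℂ} (hq : ‖q‖ < 1) (i : ℕ) :
    ∑' m, q ^ (m + i) * qPochInf (q ^ (2 * (m + i) + 1)) q * crankCoeff q (m + i) i =
      1 / qPochInf q q * (singleA1 q (i + 1) + ∑' n : ℕ, doubleA1 q (i + 1) (n + 1)) := by
  have h := tsum_bailey_A1 hq (norm_pow_odd_lt_one hq i)
  have hP := qPochInf_ne_zero_of_norm_lt_one hq hq
  have e1 : ∑' m, q ^ (m + i) * qPochInf (q ^ (2 * (m + i) + 1)) q * crankCoeff q (m + i) i =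
      (-1) ^ i * (1 - q ^ (2 * i + 1)) * q ^ i.choose 2 * q ^ i *
        ∑' m, q ^ m * (qPochInf (q ^ (2 * i + 1) * q ^ (m + 1)) q / qPoch q q m) := by
    rw [← tsum_mul_left]
    refine tsum_congr fun m => ?_
    rw [mul_assoc, qPochInf_mul_crankCoeff hq]
    ring
  have e2 : singleA1 q (i + 1) + ∑' n : ℕ, doubleA1 q (i + 1) (n + 1) =
      (-1) ^ i * q ^ (i.choose 2) * q ^ i * (1 + ∑' n : ℕ, (-q ^ (2 * i + 1)) ^ (n + 1) *
        q ^ (n + 1).choose 2 * (1 + q ^ (n + 1))) := by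
    rw [mul_add, ← tsum_mul_left, singleA1_succ, choose_succ_two, pow_add]
    congr 1
    · ring
    · refine tsum_congr fun n => ?_
      rw [doubleA1_succ, choose_succ_two i, neg_pow (q ^ (2 * i + 1)), ← pow_mul]
      ring
  rw [e1, e2, ← h]
  field_simp

theorem tsum_termA3_coeff {q : ℂ} (hq : ‖q‖ < 1) (i : ℕ) :
    ∑' m, q ^ (2 * (m + i)) * qPochInf (q ^ (2 * (m + i) + 1)) q * crankCoeff q (m + i) i =
      1 / qPochInf q q * ∑' n : ℕ, doubleA3 q (i + 1) n := by
  have h := tsum_bailey_A3 hq (norm_pow_odd_lt_one hq i)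
  have hP := qPochInf_ne_zero_of_norm_lt_one hq hq
  have e1 : ∑' m, q ^ (2 * (m + i)) * qPochInf (q ^ (2 * (m + i) + 1)) q *
        crankCoeff q (m + i) i =
      (-1) ^ i * (1 - q ^ (2 * i + 1)) * q ^ i.choose 2 * q ^ (2 * i) *
        ∑' m, (q ^ 2) ^ m * (qPochInf (q ^ (2 * i + 1) * q ^ (m + 1)) q / qPoch q q m) := by
    rw [← tsum_mul_left]
    refine tsum_congr fun m => ?_
    rw [mul_assoc, qPochInf_mul_crankCoeff hq]
    ring
  have e2 : ∑' n : ℕ, doubleA3 q (i + 1) n =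
      (-1) ^ i * q ^ (i.choose 2) * q ^ (2 * i) * ∑' n : ℕ, (-q ^ (2 * i + 1)) ^ n *
        q ^ n.choose 2 * (1 - q ^ (2 * n + 1)) := by
    rw [← tsum_mul_left]
    refine tsum_congr fun n => ?_
    rw [doubleA3_succ, choose_succ_two i, neg_pow (q ^ (2 * i + 1)), ← pow_mul]
    ring
  rw [e1, e2, ← h]
  field_simp

/-- Splitting `(q^{2n+1};q)_∞` by parity and factoring `(q^{2n+2};q^2)_∞ = (q^{n+1};q)_∞
(-q^{n+1};q)_∞` writes the weight as `q^n (q^{2n+1};q)_∞ / (-q^{n+1};q)_∞`. Then `tsum_bailey_C1`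
applies with `y = q^{i+1}`; the factor `1 - q^{2i+1}` is not consumed and survives as `1 -
q^{2k-1}`. -/
theorem tsum_termC1_coeff {q : ℂ} (hq : ‖q‖ < 1) (i : ℕ) :
    ∑' m, q ^ (m + i) * (qPochInf (q ^ (2 * (m + i) + 1)) (q ^ 2) *
        qPochInf (q ^ (m + i + 1)) q) * crankCoeff q (m + i) i =
      1 / qPochInf q q * ∑' n : ℕ, doubleC1 q (i + 1) n := by
  have hy : ‖q ^ (i + 1)‖ < 1 := by
    rw [norm_pow]; exact pow_lt_one₀ (norm_nonneg q) hq (by omega)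
  have h := tsum_bailey_C1 hq hy
  have hP := qPochInf_ne_zero_of_norm_lt_one hq hq
  have e1 : ∑' m, q ^ (m + i) * (qPochInf (q ^ (2 * (m + i) + 1)) (q ^ 2) *
        qPochInf (q ^ (m + i + 1)) q) * crankCoeff q (m + i) i =
      (-1) ^ i * (1 - q ^ (2 * i + 1)) * q ^ i.choose 2 * q ^ i *
        ∑' m, q ^ m * (qPochInf ((q ^ (i + 1)) ^ 2 * q ^ m) q /
          (qPochInf (-q ^ (i + 1) * q ^ m) q * qPoch q q m)) := by
    rw [← tsum_mul_left]
    refine tsum_congr fun m => ?_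
    have h1 := qPochInf_mul_crankCoeff hq m i
    have h2 := qPochInf_split (q ^ (2 * (m + i) + 1)) hq
    have h3 := qPochInf_sq (q ^ (m + i + 1)) hq
    have h4 : -q ^ (i + 1) * q ^ m = -q ^ (m + i + 1) := by ring
    have h5 : (q ^ (i + 1)) ^ 2 * q ^ m = q ^ (2 * i + 1) * q ^ (m + 1) := by ring
    have h6 : qPochInf (-q ^ (m + i + 1)) q ≠ 0 := by
      refine qPochInf_ne_zero_of_norm_lt_one hq ?_
      rw [norm_neg, norm_pow]; exact pow_lt_one₀ (norm_nonneg q) hq (by omega)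
    rw [← pow_succ, show 2 * (m + i) + 1 + 1 = (m + i + 1) * 2 by ring, pow_mul, h3] at h2
    rw [h2] at h1
    rw [h4, h5]
    have h7 := qPoch_q_ne_zero hq m
    rw [div_mul_eq_div_div_swap, ← mul_div_assoc, ← mul_div_assoc, eq_div_iff h6]
    linear_combination q ^ (m + i) * h1
  have e2 : ∑' n : ℕ, doubleC1 q (i + 1) n =
      (-1) ^ i * (1 - q ^ (2 * i + 1)) * q ^ i.choose 2 * q ^ i *
        ∑' n : ℕ, (q ^ (i + 1)) ^ (3 * n) * q ^ pentagonalNum n * (1 - q ^ (i + 1) * q ^ n) := by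
    rw [← tsum_mul_left]
    refine tsum_congr fun n => ?_
    rw [doubleC1_succ, choose_succ_two i]
    ring
  rw [e1, e2, ← h, mul_left_comm (1 / _), ← mul_assoc (1 / _), one_div_mul_cancel hP, one_mul]

theorem tsum_termE4_coeff {q : ℂ} (hq : ‖q‖ < 1) (i : ℕ) :
    ∑' m, q ^ (2 * (m + i)) * qPochInf (q ^ (2 * (m + i) + 2)) (q ^ 2) * crankCoeff q (m + i) i =
      1 / qPochInf q q * ∑' n : ℕ, doubleE4 q (i + 1) n := by
  -- A square root `t` of `q^{2i+1}` is needed to factor `(q^{2n+1};q^2)_∞ = (t q^m;q)_∞ (-t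
  -- q^m;q)_∞`, the quotient of `(q^{2n+1};q)_∞` by the weight's product. Either root serves, as
  -- only `t^2` appears in the evaluated sum.
  obtain ⟨s, hs⟩ := IsAlgClosed.exists_pow_nat_eq q two_pos
  have hs1 : ‖s‖ < 1 := by
    rw [← hs, norm_pow] at hq
    exact lt_of_pow_lt_pow_left₀ 2 zero_le_one (by rwa [one_pow])
  obtain ⟨t, ht⟩ : ∃ t, t = s ^ (2 * i + 1) := ⟨_, rfl⟩
  have ht1 : ‖t‖ < 1 := ht ▸ norm_pow_odd_lt_one hs1 i
  have ht2 : q ^ (2 * i + 1) = t ^ 2 := by rw [ht, ← hs]; ring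
  have h := tsum_bailey_E4 hq ht1
  have hP := qPochInf_ne_zero_of_norm_lt_one hq hq
  have e1 : ∑' m, q ^ (2 * (m + i)) * qPochInf (q ^ (2 * (m + i) + 2)) (q ^ 2) *
        crankCoeff q (m + i) i =
      (-1) ^ i * (1 - t ^ 2) * q ^ i.choose 2 * q ^ (2 * i) *
        ∑' m, (q ^ 2) ^ m * (qPochInf (t ^ 2 * q ^ (m + 1)) q /
          (qPochInf (t * q ^ m) q * qPochInf (-t * q ^ m) q * qPoch q q m)) := by
    rw [← tsum_mul_left]
    refine tsum_congr fun m => ?_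
    have h1 := qPochInf_mul_crankCoeff hq m i
    have h2 := qPochInf_split (q ^ (2 * (m + i) + 1)) hq
    have h3 := qPochInf_sq (t * q ^ m) hq
    have h4 : q ^ (2 * (m + i) + 1) = (t * q ^ m) ^ 2 := by rw [mul_pow, ← ht2]; ring
    have h6 := qPochInf_ne_zero_of_norm_lt_one hq (norm_mul_pow_lt_one hq ht1 m)
    have h8 := qPochInf_ne_zero_of_norm_lt_one hq
      (norm_mul_pow_lt_one hq (a := -t) (by rwa [norm_neg]) m)
    have h7 := qPoch_q_ne_zero hq m
    rw [← pow_succ, show 2 * (m + i) + 1 + 1 = 2 * (m + i) + 2 by ring] at h2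
    rw [h2, h4, h3, ht2, ← neg_mul] at h1
    rw [div_mul_eq_div_div_swap, ← mul_div_assoc, ← mul_div_assoc, eq_div_iff (mul_ne_zero h6 h8)]
    linear_combination q ^ (2 * (m + i)) * h1
  have e2 : ∑' n : ℕ, doubleE4 q (i + 1) n =
      (-1) ^ i * q ^ i.choose 2 * q ^ (2 * i) * ∑' n : ℕ, (-t ^ 2) ^ n *
        q ^ (n ^ 2) * (1 - q ^ (2 * n + 1)) := by
    rw [← tsum_mul_left]
    refine tsum_congr fun n => ?_
    rw [doubleE4_succ, choose_succ_two i, ← ht2, neg_pow (q ^ (2 * i + 1)), ← pow_mul q (2 * i + 1)]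
    ring
  rw [e1, e2, ← h]
  field_simp

theorem norm_pow_mul_le {q : ℂ} {s : ℕ → ℕ} (hq : ‖q‖ < 1) (hs : ∀ n, n ≤ s n) {g : ℕ → ℂ}
    {M : ℝ} (hg : ∀ n, ‖g n‖ ≤ M) (n : ℕ) : ‖q ^ s n * g n‖ ≤ M * ‖q‖ ^ n := by
  have h1 := pow_le_pow_of_le_one (norm_nonneg q) hq.le (hs n)
  rw [norm_mul, norm_pow, mul_comm]
  have := hg n
  have h2 := (norm_nonneg (g n)).trans this
  gcongr

theorem exists_norm_qPochInf_pow_odd_le {q : ℂ} (hq : ‖q‖ < 1) :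
    ∃ M : ℝ, 0 < M ∧ ∀ n : ℕ, ‖qPochInf (q ^ (2 * n + 1)) q‖ ≤ M := by
  obtain ⟨M, h, hM⟩ := exists_norm_qPochInf_shift_le hq hq
  exact ⟨M, h, fun n => by simpa [← pow_succ'] using hM (2 * n)⟩

end

theorem proposition3p1 (z q : ℂ) (hq : ‖q‖ < 1) (hz : z ≠ 0)
    (hzq : ∀ m : ℕ, 1 ≤ m → z * q ^ m ≠ 1 ∧ z⁻¹ * q ^ m ≠ 1) :
    -- the pair A1
    (Summable (fun n : ℕ => termA1 z q (n + 1)) ∧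
      Summable (fun p : ℕ × ℕ => zPair z (p.1 + 1) * doubleA1 q (p.1 + 1) (p.2 + 1)) ∧
      Summable (fun k : ℕ => zPair z (k + 1) *
        (singleA1 q (k + 1) + ∑' n : ℕ, doubleA1 q (k + 1) (n + 1))) ∧
      (1 + z) * (qPochInf z q * qPochInf z⁻¹ q) * sptCrankA1 z q =
        -(1 + z) * qPochInf q q +
          1 / qPochInf q q * ∑' k : ℕ, zPair z (k + 1) *
            (singleA1 q (k + 1) + ∑' n : ℕ, doubleA1 q (k + 1) (n + 1))) ∧
    -- the pair A3
    (Summable (fun n : ℕ => termA3 z q (n + 1)) ∧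
      Summable (fun p : ℕ × ℕ => zPair z (p.1 + 1) * doubleA3 q (p.1 + 1) p.2) ∧
      (1 + z) * (qPochInf z q * qPochInf z⁻¹ q) * sptCrankA3 z q =
        -(1 + z) * qPochInf q q +
          1 / qPochInf q q * ∑' k : ℕ, ∑' n : ℕ, zPair z (k + 1) * doubleA3 q (k + 1) n) ∧
    -- the pair C1
    (Summable (fun n : ℕ => termC1 z q (n + 1)) ∧
      Summable (fun p : ℕ × ℕ => zPair z (p.1 + 1) * doubleC1 q (p.1 + 1) p.2) ∧
      (1 + z) * (qPochInf z q * qPochInf z⁻¹ q) * sptCrankC1 z q =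
        -(1 + z) * (qPochInf q q * qPochInf q (q ^ 2)) +
          1 / qPochInf q q * ∑' k : ℕ, ∑' n : ℕ, zPair z (k + 1) * doubleC1 q (k + 1) n) ∧
    -- the pair E4
    (Summable (fun n : ℕ => termE4 z q (n + 1)) ∧
      Summable (fun p : ℕ × ℕ => zPair z (p.1 + 1) * doubleE4 q (p.1 + 1) p.2) ∧
      (1 + z) * (qPochInf z q * qPochInf z⁻¹ q) * sptCrankE4 z q =
        -(1 + z) * qPochInf (q ^ 2) (q ^ 2) +
          1 / qPochInf q q * ∑' k : ℕ, ∑' n : ℕ, zPair z (k + 1) * doubleE4 q (k + 1) n) := by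
  obtain ⟨M, hM0, hM⟩ := exists_norm_qPochInf_pow_odd_le hq
  obtain ⟨M₁, hM₁0, hM₁⟩ := exists_norm_qPochInf_shift_le hq hq
  obtain ⟨M₂, hM₂0, hM₂⟩ := exists_norm_qPochInf_shift_le (norm_sq_lt_one hq) hq
  obtain ⟨M₃, hM₃0, hM₃⟩ :=
    exists_norm_qPochInf_shift_le (norm_sq_lt_one hq) (norm_sq_lt_one hq)
  have pull : ∀ X : ℕ → ℂ, ∑' i, zPair z (i + 1) * (1 / qPochInf q q * X i) =
      1 / qPochInf q q * ∑' i, zPair z (i + 1) * X i := fun X => by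
    rw [← tsum_mul_left]
    exact tsum_congr fun i => mul_left_comm _ _ _
  refine ⟨?_, ?_, ?_, ?_⟩
  · obtain ⟨h1, h2⟩ := tsum_crank_eq hq hz hzq
      (norm_pow_mul_le hq (fun n => le_rfl) hM) (tsum_termA1_coeff hq)
    have hd := summable_zPair_mul_doubleA1 z hq
    refine ⟨h1, hd, ?_, ?_⟩
    · simp only [mul_add]
      -- The inner sums inherit summability over `k` from the pair series; the single series is
      -- bounded directly by `summable_norm_zPair_mul_pow`.
      refine Summable.add ?_ (by simpa only [tsum_mul_left] using hd.prod)
      refine Summable.of_norm_bounded (summable_norm_zPair_mul_pow z hq) fun i => ?_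
      rw [singleA1_succ, norm_mul, norm_mul, norm_pow, norm_pow, norm_neg, norm_one, one_pow,
        one_mul]
      exact mul_le_mul_of_nonneg_left
        (pow_le_pow_of_le_one (norm_nonneg q) hq.le (choose_two_le_succ i)) (norm_nonneg _)
    · rw [pull] at h2
      simpa [sptCrankA1, termA1] using h2
  · obtain ⟨h1, h2⟩ := tsum_crank_eq hq hz hzq
      (norm_pow_mul_le hq (fun n => show n ≤ 2 * n by omega) hM) (tsum_termA3_coeff hq)
    refine ⟨h1, summable_zPair_mul_doubleA3 z hq, ?_⟩
    rw [pull] at h2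
    simpa [sptCrankA3, termA3, tsum_mul_left] using h2
  · obtain ⟨h1, h2⟩ := tsum_crank_eq hq hz hzq
      (norm_pow_mul_le hq (fun n => le_rfl) (M := M₂ * M₁)
        (g := fun n => qPochInf (q ^ (2 * n + 1)) (q ^ 2) * qPochInf (q ^ (n + 1)) q)
        (fun n => by
          have a1 := hM₁ n
          have a2 := hM₂ n
          rw [← pow_succ'] at a1
          rw [← pow_mul, ← pow_succ'] at a2
          rw [norm_mul]
          gcongr)) (tsum_termC1_coeff hq)
    refine ⟨h1, summable_zPair_mul_doubleC1 z hq, ?_⟩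
    rw [pull] at h2
    simpa [sptCrankC1, termC1, tsum_mul_left, mul_comm (qPochInf q q)] using h2
  · obtain ⟨h1, h2⟩ := tsum_crank_eq hq hz hzq
      (norm_pow_mul_le hq (fun n => show n ≤ 2 * n by omega) (M := M₃)
        (g := fun n => qPochInf (q ^ (2 * n + 2)) (q ^ 2))
        (fun n => by
          have a := hM₃ n
          rwa [← pow_mul, ← pow_add, add_comm] at a)) (tsum_termE4_coeff hq)
    refine ⟨h1, summable_zPair_mul_doubleE4 z hq, ?_⟩
    rw [pull] at h2
    simpa [sptCrankE4, termE4, tsum_mul_left] using h2
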